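/- Let $G=(V,E)$ be a locally finite, infinite, connected (simple) graph. An exhaustion of a connected locally finite graph is an increasing sequence of finite connected subgraphs $G_n$ whose union is the graph. The free spanning forest measure $\mathsf{FSF}$ of the graph is the weak limit (on finite sets of edges) of the uniform spanning trees of $G_n$; the wired spanning forest measure $\mathsf{WSF}$ is, for exhaustions by induced subgraphs, the weak limit of the uniform spanning trees of $\widehat{G_n}$, the multigraph obtained by identifying all vertices not in $G_n$ to a single vertex; neither limit depends on the exhaustion. Let $\mathfrak F_{\mathrm w}$ be a sample of $\mathsf{WSF}(G)$, and let $\overline{\mathfrak F_{\mathrm w}}$ be its induced-component graph: the graph on $V$ in which an edge of $G$ is present if and only if both its endpoints lie in the same component of $\mathfrak F_{\mathrm w}$. Let $\mathsf{WSF}(\overline{\mathfrak F_{\mathrm w}})$ be the unconditional law of the random subgraph of $G$ obtained by first sampling $\overline{\mathfrak F_{\mathrm w}}$ and then sampling a wired spanning forest independently on each component of it (each component being regarded as a graph in its own right). Then $$\mathsf{WSF}(\overline{\mathfrak F_{\mathrm w}})=\mathsf{WSF}(G)$$ if and only if, almost surely, every component $K$ of $\overline{\mathfrak F_{\mathrm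 w}}$ satisfies $\mathsf{FSF}(K)=\mathsf{WSF}(K)$. -/

import Mathlib

open MeasureTheory Filter Topology

namespace SpanningForest

noncomputable section

universe u

variable {V : Type u}

/-- The spanning trees of a subgraph `H` of `G`: subgraphs `T` of `H` that are trees on the
vertex set of `H`. A tree is recorded by its edges, i.e. as a graph on `V` in which
the vertices outside `H` are isolated. -/
def spanningTrees {G : SimpleGraph V} (H : G.Subgraph) : Set (SimpleGraph V) :=
  {T | T ≤ H.spanningCoe ∧ (T.induce H.verts).IsTree}

/-- The identification of all vertices outside `S` to a single vertex. -/
def wiredSetoid (S : Set V) : Setoid V where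
  r u v := u = v ∨ (u ∉ S ∧ v ∉ S)
  iseqv :=
    { refl := fun _ => Or.inl rfl
      symm := by
        rintro u v (h | h)
        · exact Or.inl h.symm
        · exact Or.inr h.symm
      trans := by
        rintro u v w (rfl | h) (rfl | h')
        · exact Or.inl rfl
        · exact Or.inr h'
        · exact Or.inr h
        · exact Or.inr ⟨h.1, h'.2⟩ }

/-- The vertex set after all vertices outside `S` are identified to a single vertex. -/
abbrev WiredVertex (S : Set V) : Type u := Quotient (wiredSetoid S)

/-- The quotient map onto the identified vertex set. -/
def wire (S : Set V) (v : V) : WiredVertex S := Quotient.mk (wiredSetoid S) v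

/-- The spanning trees of the multigraph obtained from `G` by identifying all vertices outside
`S` to a single vertex. The edges of that multigraph are the edges of `G` (it may have loops and
parallel edges), so a spanning tree is recorded by a set of edges of `G`, as a subgraph `T ≤ G`:
no edge of `T` becomes a loop, no two edges of `T` become parallel, and the image of `T` is a tree
on the whole identified vertex set. -/
def wiredSpanningTrees (G : SimpleGraph V) (S : Set V) : Set (SimpleGraph V) :=
  {T | T ≤ G ∧ (∀ u v, T.Adj u v → wire S u ≠ wire S v) ∧
    Set.InjOn (Sym2.map (wire S)) T.edgeSet ∧ (T.map (wire S)).IsTree}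

/-- The probability of the event `A` under the uniform measure on the finite set `𝒯`. -/
def uniformProb (𝒯 A : Set (SimpleGraph V)) : ℝ :=
  ((𝒯 ∩ A).ncard : ℝ) / (𝒯.ncard : ℝ)

/-- The event that, among the finitely many pairs in `F`, exactly those in `B` are edges. -/
def cylinder (F B : Finset (Sym2 V)) : Set (SimpleGraph V) :=
  {T | T.edgeSet ∩ (F : Set (Sym2 V)) = (B : Set (Sym2 V))}

/-- `μ` is the local weak limit of the uniform measures on the finite sets `𝒯 n`: for every finite
set `F` of pairs of vertices, the law of the restriction to `F` of a uniform element of `𝒯 n`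
converges to the law of the restriction to `F` of a sample of `μ`. -/
def IsWeakLimit (𝒯 : ℕ → Set (SimpleGraph V)) (μ : ProbabilityMeasure (SimpleGraph V)) : Prop :=
  ∀ F B : Finset (Sym2 V), Tendsto (fun n => uniformProb (𝒯 n) (cylinder F B)) atTop
    (𝓝 ((μ : Measure (SimpleGraph V)).real (cylinder F B)))

/-- An exhaustion of `G`: an increasing sequence of finite connected subgraphs with union `G`. -/
structure IsExhaustion {G : SimpleGraph V} (Gn : ℕ → G.Subgraph) : Prop where
  finite : ∀ n, (Gn n).verts.Finite
  connected : ∀ n, (Gn n).Connected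
  mono : Monotone Gn
  iSup_eq_top : ⨆ n, Gn n = ⊤

/-- `μ` is the free spanning forest measure of `G`: the weak limit of the uniform spanning trees
along every exhaustion of `G`. -/
def IsFSF (G : SimpleGraph V) (μ : ProbabilityMeasure (SimpleGraph V)) : Prop :=
  ∀ Gn : ℕ → G.Subgraph, IsExhaustion Gn → IsWeakLimit (fun n => spanningTrees (Gn n)) μ

/-- `μ` is the wired spanning forest measure of `G`: the weak limit, along every exhaustion of `G`
by induced subgraphs, of the uniform spanning trees of the graphs obtained by identifying all
vertices outside the subgraph. -/
def IsWSF (G : SimpleGraph V) (μ : ProbabilityMeasure (SimpleGraph V)) : Prop :=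
  ∀ Gn : ℕ → G.Subgraph, IsExhaustion Gn → (∀ n, (Gn n).IsInduced) →
    IsWeakLimit (fun n => wiredSpanningTrees G (Gn n).verts) μ

/-- The free spanning forest `FSF(G)` of a locally finite connected graph `G`, as a law on
graphs with vertex set `V`. -/
def FSF (G : SimpleGraph V) : ProbabilityMeasure (SimpleGraph V) :=
  Classical.epsilon (IsFSF G)

/-- The wired spanning forest `WSF(G)` of a locally finite connected graph `G`, as a law on
graphs with vertex set `V`. -/
def WSF (G : SimpleGraph V) : ProbabilityMeasure (SimpleGraph V) :=
  Classical.epsilon (IsWSF G)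

/-- The induced-component graph of a spanning subgraph `F` of `G`: an edge of `G` belongs to it
if and only if both its endpoints belong to the same component of `F`. -/
def inducedComponentGraph (G F : SimpleGraph V) : SimpleGraph V where
  Adj u v := G.Adj u v ∧ F.Reachable u v
  symm.symm _ _ h := ⟨h.1.symm, h.2.symm⟩
  loopless.irrefl _ h := G.irrefl h.1

/-- The union of a family of graphs on the components of `H`, as a graph on `V`. -/
def unionOfComponents (H : SimpleGraph V) (T : ∀ c : H.ConnectedComponent, SimpleGraph c) :
    SimpleGraph V :=
  ⨆ c, (T c).map (fun v : c => (v : V))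

/-- The law of the random subgraph of the fixed graph `H` obtained by sampling a wired spanning
forest independently on each component of `H` (each component being a graph of its own). -/
def componentwiseWSF (H : SimpleGraph V) : Measure (SimpleGraph V) :=
  (Measure.infinitePi fun c : H.ConnectedComponent =>
    (WSF c.toSimpleGraph : Measure (SimpleGraph c))).map (unionOfComponents H)

/-- `WSF(H)` for a random graph `H = h(ω)` with `ω` of law `P`: the unconditional law of the
result of sampling `H` and then a wired spanning forest independently on each component of `H`. -/
def resampledWSF {Ω : Type*} [MeasurableSpace Ω] (P : Measure Ω) (h : Ω → SimpleGraph V) :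
    Measure (SimpleGraph V) :=
  P.bind fun ω => componentwiseWSF (h ω)

end

end SpanningForest

namespace SpanningForest

noncomputable section

open scoped Classical

universe u

variable {V : Type u}

/-! Write `F` for a sample of `WSF G` and `H` for its induced-component graph. The heart of the
matter is that `WSF G` is a mixture of free forests: the probability that a finite edge set `B` lies
in `F` is the expectation of `freeProb H B` (`WSF_upperEvent_eq_integral_freeProb`). By construction
the resampled law gives `B` the expectation of `wiredProb H B` (`resampledWSF_upperEvent`). Since
`wiredProb H B ≤ freeProb H B` for every locally finite `H` (`wiredProb_le_freeProb`), the two laws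
agree exactly when, for each of the countably many `B`, the two integrands agree almost surely. Both
probabilities factor over the components of `H`, so this says that free and wired forests agree on
every component (`forall_FSF_eq_WSF_iff`).

The mixture formula comes from an exact finite symmetry. In a uniform spanning tree of a finite
wired graph, the part inside an edge set `D` may be replaced by a uniform spanning forest with the
same components inside `D` (`card_filter_eq_sum_baseProb`). For fixed `D` only finitely many edges
matter, so this survives the wired limit (`WSF_upperEvent_eq_integral`). Now let `D` grow: the edges
of `D` whose endpoints are joined by `F ∩ D` exhaust `H`, and nothing is wired in them, so free
forests of `H` appear.

The limits and the inequality rest on Rayleigh monotonicity (`baseProb_anti`). For one edge, the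
transfer current matrix is the symmetric projection onto potential differences, its diagonal entries
are squared norms, and Cauchy–Schwarz compares two of them. Conditioning on an edge is contracting
it (`baseProb_insert`), which gives all finite sets by induction. Every finite model is treated as
the bases of a graphic matroid with a set `C` of contracted pairs: `C = ∅` is the free case and `C =
outsidePairs S` the wired one. -/

/-! ### Edges, cuts and spanning -/

/-- The source of an edge, for a fixed arbitrary orientation. -/
def edgeSrc (e : Sym2 V) : V := (Quot.out e).1

/-- The target of an edge, for a fixed arbitrary orientation. -/
def edgeTgt (e : Sym2 V) : V := (Quot.out e).2

lemma mk_edgeSrc_edgeTgt (e : Sym2 V) : s(edgeSrc e, edgeTgt e) = e := Quot.out_eq e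

/-- The function `g` takes the same value at both endpoints of `e`. -/
def ConstOn {α : Type*} (g : V → α) (e : Sym2 V) : Prop := g (edgeSrc e) = g (edgeTgt e)

lemma constOn_mk {α : Type*} (g : V → α) (u v : V) : ConstOn g s(u, v) ↔ g u = g v := by
  have h := mk_edgeSrc_edgeTgt s(u, v)
  rw [Sym2.eq_iff] at h
  unfold ConstOn
  rcases h with ⟨h1, h2⟩ | ⟨h1, h2⟩
  · rw [h1, h2]
  · rw [h1, h2]; exact eq_comm

/-- The edge `e` joins two vertices that are connected by the edges in `A`: every cut that
avoids `A` avoids `e`. -/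
def Spans (A : Set (Sym2 V)) (e : Sym2 V) : Prop :=
  ∀ ψ : V → Prop, (∀ a ∈ A, ConstOn ψ a) → ConstOn ψ e

/-- Two-valued cuts control functions of any type: apply the definition to the level set of `g`
through one endpoint of `e`. -/
lemma Spans.constOn {α : Type*} {A : Set (Sym2 V)} {e : Sym2 V} (h : Spans A e) (g : V → α)
    (hg : ∀ a ∈ A, ConstOn g a) : ConstOn g e := by
  have := h (fun v => g v = g (edgeSrc e)) fun a ha => by
    have := hg a ha
    unfold ConstOn at this ⊢
    simp only [this]
  unfold ConstOn at this ⊢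
  exact (this.mp rfl).symm

lemma spans_of_mem {A : Set (Sym2 V)} {e : Sym2 V} (h : e ∈ A) : Spans A e :=
  fun _ hψ => hψ e h

lemma Spans.trans {A B : Set (Sym2 V)} {e : Sym2 V} (h : Spans B e) (hB : ∀ b ∈ B, Spans A b) :
    Spans A e := fun ψ hψ => h ψ fun b hb => hB b hb ψ hψ

lemma Spans.mono {A B : Set (Sym2 V)} {e : Sym2 V} (h : Spans A e) (hAB : A ⊆ B) : Spans B e :=
  h.trans fun _ ha => spans_of_mem (hAB ha)

lemma spans_congr {A B : Set (Sym2 V)} (hAB : ∀ a ∈ A, Spans B a) (hBA : ∀ b ∈ B, Spans A b)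
    (e : Sym2 V) : Spans A e ↔ Spans B e :=
  ⟨fun h => h.trans hAB, fun h => h.trans hBA⟩

lemma spans_of_isDiag {A : Set (Sym2 V)} {e : Sym2 V} (h : e.IsDiag) : Spans A e := by
  induction e with
  | _ u v =>
    rw [Sym2.mk_isDiag_iff] at h
    subst h
    exact fun ψ _ => (constOn_mk ψ u u).2 rfl

/-- The difference of the values of `g` at the endpoints of `e`. -/
def cobd (g : V → ℝ) (e : Sym2 V) : ℝ := g (edgeSrc e) - g (edgeTgt e)

lemma cobd_eq_zero {g : V → ℝ} {e : Sym2 V} : cobd g e = 0 ↔ ConstOn g e := sub_eq_zero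

lemma cobd_sum {κ : Type*} (I : Finset κ) (c : κ → ℝ) (g : κ → V → ℝ) (e : Sym2 V) :
    cobd (fun v => ∑ i ∈ I, c i * g i v) e = ∑ i ∈ I, c i * cobd (g i) e := by
  simp only [cobd, mul_sub, Finset.sum_sub_distrib]

lemma cobd_sub (g h : V → ℝ) (e : Sym2 V) : cobd (fun v => g v - h v) e = cobd g e - cobd h e := by
  simp only [cobd]; ring

lemma not_spans_of_cobd {A : Set (Sym2 V)} {e : Sym2 V} (g : V → ℝ)
    (hg : ∀ a ∈ A, cobd g a = 0) (he : cobd g e ≠ 0) : ¬ Spans A e := fun h =>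
  he (cobd_eq_zero.2 (h.constOn g fun a ha => cobd_eq_zero.1 (hg a ha)))

/-- The indicator of the side of a separating cut that contains the source of `e`. Together with
`not_spans_of_cobd` it turns independence into linear algebra over `ℝ`. -/
lemma exists_potential {A : Set (Sym2 V)} {e : Sym2 V} (h : ¬ Spans A e) :
    ∃ φ : V → ℝ, (∀ v, φ v = 0 ∨ φ v = 1) ∧ (∀ a ∈ A, cobd φ a = 0) ∧ cobd φ e = 1 := by
  unfold Spans at h
  push Not at h
  obtain ⟨ψ, hψ, he⟩ := h
  refine ⟨fun v => if ψ v = ψ (edgeSrc e) then 1 else 0, fun v => ?_, fun a ha => ?_, ?_⟩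
  · dsimp only
    split_ifs <;> simp
  · have := hψ a ha
    unfold ConstOn at this
    simp only [cobd, this, sub_self]
  · unfold ConstOn at he
    simp only [cobd]
    rw [if_pos trivial, if_neg (fun h => he h.symm), sub_zero]

/-! ### Bases -/

/-- `T` is a maximal spanning forest of the graph with edges `E` after the edges in `C` have been
contracted. -/
structure IsBase (C : Set (Sym2 V)) (E T : Finset (Sym2 V)) : Prop where
  subset : T ⊆ E
  spans : ∀ e ∈ E, Spans (C ∪ T) e
  indep : ∀ b ∈ T, ¬ Spans (C ∪ (T.erase b : Finset (Sym2 V))) b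

/-- The finite set of all maximal spanning forests. -/
def bases (C : Set (Sym2 V)) (E : Finset (Sym2 V)) : Finset (Finset (Sym2 V)) :=
  E.powerset.filter (IsBase C E)

lemma mem_bases {C : Set (Sym2 V)} {E T : Finset (Sym2 V)} : T ∈ bases C E ↔ IsBase C E T := by
  simp only [bases, Finset.mem_filter, Finset.mem_powerset, and_iff_right_iff_imp]
  exact fun h => h.subset

/-- A minimal spanning subset is independent, since a redundant element could be removed. This keeps
all the uniform measures free of division by zero. -/
lemma bases_nonempty (C : Set (Sym2 V)) (E : Finset (Sym2 V)) : (bases C E).Nonempty := by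
  obtain ⟨T, hT⟩ := (E.powerset.filter fun T : Finset (Sym2 V) => ∀ e ∈ E, Spans (C ∪ T) e).exists_minimal
    ⟨E, by
      simp only [Finset.mem_filter, Finset.mem_powerset, subset_refl, true_and]
      exact fun e he => spans_of_mem (Or.inr he)⟩
  have hT1 := hT.prop
  simp only [Finset.mem_filter, Finset.mem_powerset] at hT1
  refine ⟨T, mem_bases.2 ⟨hT1.1, hT1.2, fun b hb hs => ?_⟩⟩
  have hle := hT.le_of_le (y := T.erase b) ?_ (Finset.erase_subset b T)
  · exact Finset.notMem_erase b T (hle hb)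
  · simp only [Finset.mem_filter, Finset.mem_powerset]
    refine ⟨(Finset.erase_subset b T).trans hT1.1, fun e he => (hT1.2 e he).trans ?_⟩
    rintro a (ha | ha)
    · exact spans_of_mem (Or.inl ha)
    · by_cases hab : a = b
      · rw [hab]; exact hs
      · exact spans_of_mem (Or.inr (by simpa [hab] using ha))

/-- The proportion of maximal spanning forests that contain `B`. -/
def baseProb (C : Set (Sym2 V)) (E B : Finset (Sym2 V)) : ℝ :=
  (((bases C E).filter (B ⊆ ·)).card : ℝ) / ((bases C E).card : ℝ)

lemma baseProb_nonneg (C : Set (Sym2 V)) (E B : Finset (Sym2 V)) : 0 ≤ baseProb C E B := by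
  unfold baseProb; positivity

lemma card_bases_pos (C : Set (Sym2 V)) (E : Finset (Sym2 V)) : (0 : ℝ) < (bases C E).card := by
  exact_mod_cast (bases_nonempty C E).card_pos

lemma baseProb_le_one (C : Set (Sym2 V)) (E B : Finset (Sym2 V)) : baseProb C E B ≤ 1 := by
  unfold baseProb
  rw [div_le_one (card_bases_pos C E)]
  exact_mod_cast Finset.card_filter_le _ _

lemma baseProb_empty (C : Set (Sym2 V)) (E : Finset (Sym2 V)) : baseProb C E ∅ = 1 := by
  unfold baseProb
  simp [(card_bases_pos C E).ne']

lemma baseProb_eq_zero {C : Set (Sym2 V)} {E B : Finset (Sym2 V)} (h : ¬ B ⊆ E) :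
    baseProb C E B = 0 := by
  unfold baseProb
  rw [Finset.filter_eq_empty_iff.2, Finset.card_empty, Nat.cast_zero, zero_div]
  exact fun T hT hB => h (hB.trans (mem_bases.1 hT).subset)

/-- For `b` in a base `T`, a potential vanishing on the differences over `T` other than `b`. -/
def dualPot (C : Set (Sym2 V)) (T : Finset (Sym2 V)) (b : Sym2 V) : V → ℝ :=
  -- The value `0` is a mere default: for `b` in a base, independence rules this case out.
  if h : Spans (C ∪ (T.erase b : Finset (Sym2 V))) b then 0 else (exists_potential h).choose

lemma dualPot_zero_or_one (C : Set (Sym2 V)) (T : Finset (Sym2 V)) (b : Sym2 V) (v : V) :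
    dualPot C T b v = 0 ∨ dualPot C T b v = 1 := by
  unfold dualPot
  split_ifs with h
  · exact Or.inl rfl
  · exact (exists_potential h).choose_spec.1 v

/-- Fundamental cuts have entries in `{0, 1, -1}`, so a nonzero coefficient is its own inverse; the
exchange identity needs this. -/
lemma cobd_dualPot_mem (C : Set (Sym2 V)) (T : Finset (Sym2 V)) (b e : Sym2 V) :
    cobd (dualPot C T b) e = 0 ∨ cobd (dualPot C T b) e = 1 ∨ cobd (dualPot C T b) e = -1 := by
  unfold cobd
  rcases dualPot_zero_or_one C T b (edgeSrc e) with h | h <;>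
    rcases dualPot_zero_or_one C T b (edgeTgt e) with h' | h' <;> rw [h, h'] <;> norm_num

namespace IsBase

variable {C : Set (Sym2 V)} {E T : Finset (Sym2 V)} {b : Sym2 V}

lemma cobd_dualPot_contracted (h : IsBase C E T) (hb : b ∈ T) {a : Sym2 V} (ha : a ∈ C) :
    cobd (dualPot C T b) a = 0 := by
  unfold dualPot
  rw [dif_neg (h.indep b hb)]
  exact (exists_potential (h.indep b hb)).choose_spec.2.1 a (Or.inl ha)

lemma cobd_dualPot_of_ne (h : IsBase C E T) (hb : b ∈ T) {a : Sym2 V} (ha : a ∈ T) (hab : a ≠ b) :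
    cobd (dualPot C T b) a = 0 := by
  unfold dualPot
  rw [dif_neg (h.indep b hb)]
  exact (exists_potential (h.indep b hb)).choose_spec.2.1 a (Or.inr (by simp [hab, ha]))

lemma cobd_dualPot_self (h : IsBase C E T) (hb : b ∈ T) : cobd (dualPot C T b) b = 1 := by
  unfold dualPot
  rw [dif_neg (h.indep b hb)]
  exact (exists_potential (h.indep b hb)).choose_spec.2.2

/-- Interpolation: differences may be prescribed freely along a base, because the dual potentials
are dual to its elements. -/
lemma sum_dualPot_mem (h : IsBase C E T) (c : Sym2 V → ℝ) (hb : b ∈ T) :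
    cobd (fun v => ∑ a ∈ T, c a * dualPot C T a v) b = c b := by
  rw [cobd_sum, Finset.sum_eq_single_of_mem b hb, h.cobd_dualPot_self hb, mul_one]
  intro a ha hab
  rw [h.cobd_dualPot_of_ne ha hb hab.symm, mul_zero]

lemma sum_dualPot_contracted (h : IsBase C E T) (c : Sym2 V → ℝ) {a : Sym2 V} (ha : a ∈ C) :
    cobd (fun v => ∑ b ∈ T, c b * dualPot C T b v) a = 0 := by
  rw [cobd_sum]
  exact Finset.sum_eq_zero fun b hb => by rw [h.cobd_dualPot_contracted hb ha, mul_zero]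

/-- The differences of a potential are determined by those over a base. -/
lemma cobd_expansion (h : IsBase C E T) (g : V → ℝ) (hg : ∀ a ∈ C, cobd g a = 0) {e : Sym2 V}
    (he : e ∈ E) : cobd g e = ∑ b ∈ T, cobd g b * cobd (dualPot C T b) e := by
  rw [← cobd_sum T (fun b => cobd g b) (dualPot C T), ← sub_eq_zero, ← cobd_sub, cobd_eq_zero]
  refine (h.spans e he).constOn _ ?_
  rintro a (ha | ha)
  · rw [← cobd_eq_zero, cobd_sub, hg a ha, h.sum_dualPot_contracted _ ha, sub_zero]
  · rw [← cobd_eq_zero, cobd_sub, h.sum_dualPot_mem _ ha, sub_self]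

/-- Exchange of a single element of a base. -/
lemma exchange (h : IsBase C E T) (hb : b ∈ T) {e : Sym2 V} (he : e ∈ E)
    (hne : cobd (dualPot C T b) e ≠ 0) : IsBase C E (insert e (T.erase b)) := by
  refine ⟨?_, fun f hf => ?_, ?_⟩
  · exact Finset.insert_subset he ((Finset.erase_subset _ _).trans h.subset)
  · refine (h.spans f hf).trans ?_
    rintro a (ha | ha)
    · exact spans_of_mem (Or.inl ha)
    by_cases hab : a = b
    · subst hab
      -- A potential that vanishes on the new set but not on the removed element would, by expansion
      -- in the old base at `e`, force the coefficient of `e` to be zero.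
      by_contra hs
      obtain ⟨g, -, hg, hga⟩ := exists_potential hs
      have h1 := h.cobd_expansion g (fun c hc => hg c (Or.inl hc)) he
      rw [hg e (Or.inr (by simp)), Finset.sum_eq_single_of_mem a hb, hga, one_mul] at h1
      · exact hne h1.symm
      · intro c hc hca
        rw [hg c (Or.inr (by simp [hc, hca])), zero_mul]
    · exact spans_of_mem (Or.inr (by simp only [Finset.coe_insert, Finset.coe_erase]
                                     exact Or.inr ⟨ha, hab⟩))
  · intro a ha
    rw [Finset.mem_insert] at ha
    by_cases hae : a = e
    · subst hae
      refine not_spans_of_cobd (dualPot C T b) ?_ hne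
      rintro c (hc | hc)
      · exact h.cobd_dualPot_contracted hb hc
      · simp only [Finset.coe_erase, Finset.coe_insert, Set.mem_sdiff, Set.mem_insert_iff,
          Finset.mem_coe, Set.mem_singleton_iff] at hc
        rcases hc.1 with hc1 | hc1
        · exact absurd hc1 hc.2
        · exact h.cobd_dualPot_of_ne hb hc1.1 hc1.2
    · have ha' : a ∈ T ∧ a ≠ b := by simpa [hae, and_comm] using ha
      -- The multiple of the cut of `b` to subtract from the cut of `a` so that the difference over
      -- `e` cancels.
      set q := cobd (dualPot C T a) e / cobd (dualPot C T b) e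
      have hcob : ∀ f, cobd (fun v => dualPot C T a v - ∑ i ∈ {b}, q * dualPot C T i v) f =
          cobd (dualPot C T a) f - q * cobd (dualPot C T b) f := fun f => by
        rw [cobd_sub, cobd_sum, Finset.sum_singleton]
      refine not_spans_of_cobd (fun v => dualPot C T a v - ∑ i ∈ {b}, q * dualPot C T i v) ?_ ?_
      · rintro c (hc | hc)
        · rw [hcob, h.cobd_dualPot_contracted hb hc, h.cobd_dualPot_contracted ha'.1 hc]; ring
        · simp only [Finset.coe_erase, Finset.coe_insert, Set.mem_sdiff, Set.mem_insert_iff,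
            Finset.mem_coe, Set.mem_singleton_iff] at hc
          rw [hcob]
          rcases hc.1 with hc1 | hc1
          · rw [hc1, div_mul_cancel₀ _ hne, sub_self]
          · rw [h.cobd_dualPot_of_ne hb hc1.1 hc1.2, h.cobd_dualPot_of_ne ha'.1 hc1.1 hc.2]; ring
      · rw [hcob, h.cobd_dualPot_self ha'.1, h.cobd_dualPot_of_ne hb ha'.1 ha'.2]
        norm_num

lemma notMem_of_cobd_ne_zero (h : IsBase C E T) (hb : b ∈ T) {e : Sym2 V} (heb : e ≠ b)
    (hne : cobd (dualPot C T b) e ≠ 0) : e ∉ T :=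
  fun he => hne (h.cobd_dualPot_of_ne hb he heb)

/-- The coefficients before and after an exchange agree. -/
lemma cobd_dualPot_exchange (h : IsBase C E T) (hb : b ∈ T) {e : Sym2 V} (he : e ∈ E)
    (heb : e ≠ b) (hne : cobd (dualPot C T b) e ≠ 0) :
    cobd (dualPot C (insert e (T.erase b)) e) b = cobd (dualPot C T b) e := by
  have h' := h.exchange hb he hne
  have heT' : e ∈ insert e (T.erase b) := Finset.mem_insert_self _ _
  -- Expanding the new dual potential in the old base at `e` shows that the product of the two
  -- coefficients is `1`; the old one is `±1`, so they coincide.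
  have h1 := h.cobd_expansion (dualPot C (insert e (T.erase b)) e)
    (fun c hc => h'.cobd_dualPot_contracted heT' hc) he
  have heT := h.notMem_of_cobd_ne_zero hb heb hne
  rw [h'.cobd_dualPot_self heT', Finset.sum_eq_single_of_mem b hb] at h1
  · rcases cobd_dualPot_mem C T b e with h2 | h2 | h2
    · exact absurd h2 hne
    · rw [h2] at h1 ⊢; linarith
    · rw [h2] at h1 ⊢; linarith
  · intro c hc hcb
    rw [h'.cobd_dualPot_of_ne heT' (Finset.mem_insert_of_mem (Finset.mem_erase.2 ⟨hcb, hc⟩))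
      (fun hce => heT (hce ▸ hc)), zero_mul]

end IsBase

/-! ### The transfer current matrix -/

/-- The potential of the averaged unit current through `e`. -/
def currentPot (C : Set (Sym2 V)) (E : Finset (Sym2 V)) (e : Sym2 V) (v : V) : ℝ :=
  ∑ T ∈ bases C E, (if e ∈ T then ((bases C E).card : ℝ)⁻¹ else 0) * dualPot C T e v

/-- The transfer current matrix. -/
def transfer (C : Set (Sym2 V)) (E : Finset (Sym2 V)) (e f : Sym2 V) : ℝ :=
  cobd (currentPot C E e) f

lemma transfer_eq (C : Set (Sym2 V)) (E : Finset (Sym2 V)) (e f : Sym2 V) :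
    transfer C E e f = ((bases C E).card : ℝ)⁻¹ *
      ∑ T ∈ bases C E, if e ∈ T then cobd (dualPot C T e) f else 0 := by
  unfold transfer currentPot
  rw [cobd_sum, Finset.mul_sum]
  refine Finset.sum_congr rfl fun T _ => ?_
  split_ifs <;> simp

lemma transfer_contracted (C : Set (Sym2 V)) (E : Finset (Sym2 V)) (e : Sym2 V) {a : Sym2 V}
    (ha : a ∈ C) : transfer C E e a = 0 := by
  rw [transfer_eq, Finset.sum_eq_zero, mul_zero]
  intro T hT
  split_ifs with h
  · exact (mem_bases.1 hT).cobd_dualPot_contracted h ha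
  · rfl

/-- Kirchhoff's formula: each base through `e` contributes the unit jump of its dual potential
across `e`. -/
lemma transfer_self (C : Set (Sym2 V)) (E : Finset (Sym2 V)) (e : Sym2 V) :
    transfer C E e e = baseProb C E {e} := by
  rw [transfer_eq, baseProb, div_eq_inv_mul, Finset.card_filter]
  push_cast
  congr 1
  refine Finset.sum_congr rfl fun T hT => ?_
  simp only [Finset.singleton_subset_iff]
  split_ifs with h
  · exact (mem_bases.1 hT).cobd_dualPot_self h
  · rfl

/-- The exchange of `e` for `f` is a bijection between the bases with nonzero terms on the two
sides, and it preserves the terms by `cobd_dualPot_exchange`. -/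
lemma transfer_symm (C : Set (Sym2 V)) {E : Finset (Sym2 V)} {e f : Sym2 V} (he : e ∈ E)
    (hf : f ∈ E) : transfer C E e f = transfer C E f e := by
  by_cases hef : e = f
  · rw [hef]
  rw [transfer_eq, transfer_eq]
  congr 1
  have key : ∀ {e f : Sym2 V}, e ∈ E → f ∈ E → e ≠ f → ∀ T ∈ bases C E,
      (if e ∈ T then cobd (dualPot C T e) f else 0) ≠ 0 →
      e ∈ T ∧ f ∉ T ∧ cobd (dualPot C T e) f ≠ 0 ∧ insert f (T.erase e) ∈ bases C E := by
    intro e f he hf hef T hT hne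
    have hb := mem_bases.1 hT
    have heT : e ∈ T := by
      by_contra h
      exact hne (if_neg h)
    rw [if_pos heT] at hne
    exact ⟨heT, hb.notMem_of_cobd_ne_zero heT (Ne.symm hef) hne, hne,
      mem_bases.2 (hb.exchange heT hf hne)⟩
  refine Finset.sum_bij_ne_zero (fun T _ _ => insert f (T.erase e)) ?_ ?_ ?_ ?_
  · intro T hT hne
    exact (key he hf hef T hT hne).2.2.2
  · intro T₁ hT₁ hne₁ T₂ hT₂ hne₂ heq
    obtain ⟨h1, h2, -, -⟩ := key he hf hef T₁ hT₁ hne₁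
    obtain ⟨h3, h4, -, -⟩ := key he hf hef T₂ hT₂ hne₂
    have h5 : (insert f (T₁.erase e)).erase f = (insert f (T₂.erase e)).erase f := by rw [heq]
    rw [Finset.erase_insert (by simp [h2]), Finset.erase_insert (by simp [h4])] at h5
    rw [← Finset.insert_erase h1, ← Finset.insert_erase h3, h5]
  · intro T hT hne
    obtain ⟨h1, h2, h3, h4⟩ := key hf he (Ne.symm hef) T hT hne
    have hb := mem_bases.1 hT
    refine ⟨insert e (T.erase f), h4, ?_, ?_⟩
    · rw [if_pos (Finset.mem_insert_self _ _), hb.cobd_dualPot_exchange h1 he hef h3]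
      exact h3
    · rw [Finset.erase_insert (by simp [h2]), Finset.insert_erase h1]
  · intro T hT hne
    obtain ⟨h1, h2, h3, h4⟩ := key he hf hef T hT hne
    rw [if_pos h1, if_pos (Finset.mem_insert_self _ _),
      (mem_bases.1 hT).cobd_dualPot_exchange h1 hf (Ne.symm hef) h3]

/-- The reproducing property of the transfer matrix on potential differences: average
`cobd_expansion` over all bases. -/
lemma cobd_eq_sum_transfer {C : Set (Sym2 V)} {E : Finset (Sym2 V)} (g : V → ℝ)
    (hg : ∀ a ∈ C, cobd g a = 0) {e : Sym2 V} (he : e ∈ E) :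
    cobd g e = ∑ f ∈ E, cobd g f * transfer C E f e := by
  have h1 : ∀ T ∈ bases C E, cobd g e =
      ∑ f ∈ E, cobd g f * if f ∈ T then cobd (dualPot C T f) e else 0 := by
    intro T hT
    rw [(mem_bases.1 hT).cobd_expansion g hg he]
    simp only [mul_ite, mul_zero]
    rw [← Finset.sum_filter, Finset.filter_mem_eq_inter,
      Finset.inter_eq_right.2 (mem_bases.1 hT).subset]
  have h2 := Finset.sum_congr rfl h1
  rw [Finset.sum_const, nsmul_eq_mul, Finset.sum_comm] at h2
  have h3 : cobd g e = ((bases C E).card : ℝ)⁻¹ * (((bases C E).card : ℝ) * cobd g e) := by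
    rw [← mul_assoc, inv_mul_cancel₀ (card_bases_pos C E).ne', one_mul]
  rw [h3, h2, Finset.mul_sum]
  refine Finset.sum_congr rfl fun f _ => ?_
  rw [transfer_eq, ← Finset.mul_sum]
  ring

/-- A symmetric idempotent has squared row norms on its diagonal; apply the reproducing property to
the current of `e` itself. -/
lemma transfer_self_eq_sum_sq (C : Set (Sym2 V)) {E : Finset (Sym2 V)} {e : Sym2 V} (he : e ∈ E) :
    transfer C E e e = ∑ f ∈ E, transfer C E e f ^ 2 := by
  rw [transfer, cobd_eq_sum_transfer _ (fun a ha => transfer_contracted C E e ha) he]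
  refine Finset.sum_congr rfl fun f hf => ?_
  rw [← transfer, transfer_symm C hf he, sq]

/-- Rayleigh monotonicity for a single edge. -/
lemma baseProb_singleton_anti {C₁ C₂ : Set (Sym2 V)} {E₁ E₂ : Finset (Sym2 V)} (hC : C₁ ⊆ C₂)
    (hE : E₁ ⊆ E₂) {e : Sym2 V} (he : e ∈ E₁) :
    baseProb C₂ E₂ {e} ≤ baseProb C₁ E₁ {e} := by
  have h0 := baseProb_nonneg C₂ E₂ {e}
  have h0' := baseProb_nonneg C₁ E₁ {e}
  rw [← transfer_self] at h0 h0' ⊢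
  rw [← transfer_self] at ⊢
  -- The second current also vanishes on the smaller set `C₁`, so the first kernel reproduces it:
  -- the diagonal entry is an inner product of the two rows over `E₁`.
  have h1 : transfer C₂ E₂ e e = ∑ f ∈ E₁, transfer C₂ E₂ e f * transfer C₁ E₁ e f := by
    rw [transfer, cobd_eq_sum_transfer (C := C₁) _
      (fun a ha => transfer_contracted C₂ E₂ e (hC ha)) he]
    exact Finset.sum_congr rfl fun f hf => by rw [← transfer, transfer_symm C₁ hf he]
  -- With `y₁`, `y₂` the two diagonal entries, Cauchy–Schwarz and the restriction of the second norm
  -- to `E₁` give `y₂ ^ 2 ≤ y₂ * y₁`.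
  have h2 := Finset.sum_mul_sq_le_sq_mul_sq E₁ (transfer C₂ E₂ e) (transfer C₁ E₁ e)
  rw [← h1, ← transfer_self_eq_sum_sq C₁ he] at h2
  have h3 : ∑ f ∈ E₁, transfer C₂ E₂ e f ^ 2 ≤ transfer C₂ E₂ e e := by
    rw [transfer_self_eq_sum_sq C₂ (hE he)]
    exact Finset.sum_le_sum_of_subset_of_nonneg hE fun _ _ _ => sq_nonneg _
  have h4 := h2.trans (mul_le_mul_of_nonneg_right h3 h0')
  by_contra hlt
  push Not at hlt
  nlinarith

/-! ### Contraction and Rayleigh monotonicity -/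

lemma IsBase.not_spans {C : Set (Sym2 V)} {E T : Finset (Sym2 V)} (h : IsBase C E T) {b : Sym2 V}
    (hb : b ∈ T) : ¬ Spans C b := fun hs => h.indep b hb (hs.mono Set.subset_union_left)

lemma IsBase.erase {C : Set (Sym2 V)} {E T : Finset (Sym2 V)} (h : IsBase C E T) {b : Sym2 V}
    (hb : b ∈ T) : IsBase (insert b C) (E.erase b) (T.erase b) := by
  refine ⟨Finset.erase_subset_erase _ h.subset, fun e he => ?_, fun a ha hs => ?_⟩
  · refine (h.spans e (Finset.mem_of_mem_erase he)).mono fun x hx => ?_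
    by_cases hxb : x = b
    · exact Or.inl (Or.inl hxb)
    · exact hx.imp Or.inr fun hx => by simpa [hxb] using hx
  · obtain ⟨hab, haT⟩ := Finset.mem_erase.1 ha
    refine h.indep a haT (hs.mono ?_)
    rintro x ((rfl | hx) | hx)
    · exact Or.inr (by simp [hb, Ne.symm hab])
    · exact Or.inl hx
    · simp only [Finset.coe_erase, Set.mem_sdiff, Finset.mem_coe, Set.mem_singleton_iff] at hx
      exact Or.inr (by simp [hx.2, hx.1.1])

lemma IsBase.insert_of_contract {C : Set (Sym2 V)} {E T : Finset (Sym2 V)} {b : Sym2 V} (hbE : b ∈ E)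
    (hbC : ¬ Spans C b) (h : IsBase (insert b C) (E.erase b) T) : IsBase C E (insert b T) := by
  have hbT : b ∉ T := fun hb => Finset.notMem_erase b E (h.subset hb)
  refine ⟨Finset.insert_subset hbE (h.subset.trans (Finset.erase_subset _ _)), fun e he => ?_,
    fun a ha => ?_⟩
  · by_cases heb : e = b
    · exact spans_of_mem (Or.inr (by simp [heb]))
    · refine (h.spans e (Finset.mem_erase.2 ⟨heb, he⟩)).mono ?_
      rintro x ((rfl | hx) | hx)
      · exact Or.inr (by simp)
      · exact Or.inl hx
      · exact Or.inr (by simp [Finset.mem_coe.1 hx])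
  · by_cases hab : a = b
    · subst hab
      rw [Finset.erase_insert hbT]
      -- Take a cut separating `b` over `C` and cancel its differences along `T` with dual
      -- potentials of the contracted base. The correction vanishes at `b`, which is contracted
      -- there, so the difference at `b` stays `1`.
      obtain ⟨ψ, -, hψ, hψa⟩ := exists_potential hbC
      have hsub : ∀ f, cobd (fun v => ψ v - ∑ t ∈ T, cobd ψ t * dualPot (insert a C) T t v) f =
          cobd ψ f - cobd (fun v => ∑ t ∈ T, cobd ψ t * dualPot (insert a C) T t v) f :=
        fun f => cobd_sub _ _ f
      refine not_spans_of_cobd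
        (fun v => ψ v - ∑ t ∈ T, cobd ψ t * dualPot (insert a C) T t v) ?_ ?_
      · rintro c (hc | hc)
        · rw [hsub, hψ c hc, h.sum_dualPot_contracted _ (Or.inr hc), sub_zero]
        · rw [hsub, h.sum_dualPot_mem _ hc, sub_self]
      · rw [hsub, hψa, h.sum_dualPot_contracted _ (Or.inl rfl)]
        norm_num
    · have haT : a ∈ T := by simpa [hab] using ha
      refine fun hs => h.indep a haT (hs.mono ?_)
      rintro x (hx | hx)
      · exact Or.inl (Or.inr hx)
      · simp only [Finset.coe_erase, Finset.coe_insert, Set.mem_sdiff, Set.mem_insert_iff,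
          Finset.mem_coe, Set.mem_singleton_iff] at hx
        rcases hx.1 with hx1 | hx1
        · exact Or.inl (Or.inl hx1)
        · exact Or.inr (by simp [hx1, hx.2])

lemma card_bases_filter_insert {C : Set (Sym2 V)} {E B : Finset (Sym2 V)} {b : Sym2 V}
    (hbE : b ∈ E) (hbB : b ∉ B) (hbC : ¬ Spans C b) :
    ((bases C E).filter (insert b B ⊆ ·)).card =
      ((bases (insert b C) (E.erase b)).filter (B ⊆ ·)).card := by
  refine Finset.card_nbij' (fun T => T.erase b) (fun T => insert b T) ?_ ?_ ?_ ?_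
  · intro T hT
    simp only [Finset.coe_filter, Set.mem_ofPred_eq, mem_bases, Finset.insert_subset_iff] at hT ⊢
    exact ⟨hT.1.erase hT.2.1, Finset.subset_erase.2 ⟨hT.2.2, hbB⟩⟩
  · intro T hT
    simp only [Finset.coe_filter, Set.mem_ofPred_eq, mem_bases] at hT ⊢
    exact ⟨hT.1.insert_of_contract hbE hbC, Finset.insert_subset_insert _ hT.2⟩
  · intro T hT
    simp only [Finset.coe_filter, Set.mem_ofPred_eq, Finset.insert_subset_iff] at hT
    exact Finset.insert_erase hT.2.1
  · intro T hT
    simp only [Finset.coe_filter, Set.mem_ofPred_eq, mem_bases] at hT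
    exact Finset.erase_insert fun hb => Finset.notMem_erase b E (hT.1.subset hb)

/-- The chain rule: conditioning on `b` amounts to contracting it. If `b` is already a loop, both
sides vanish. -/
lemma baseProb_insert {C : Set (Sym2 V)} {E B : Finset (Sym2 V)} {b : Sym2 V}
    (hbE : b ∈ E) (hbB : b ∉ B) :
    baseProb C E (insert b B) = baseProb C E {b} * baseProb (insert b C) (E.erase b) B := by
  by_cases hbC : Spans C b
  · have h0 : ∀ A : Finset (Sym2 V), b ∈ A → baseProb C E A = 0 := fun A hA => by
      unfold baseProb
      rw [Finset.filter_eq_empty_iff.2, Finset.card_empty, Nat.cast_zero, zero_div]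
      exact fun T hT hAT => (mem_bases.1 hT).not_spans (hAT hA) hbC
    rw [h0 _ (Finset.mem_insert_self _ _), h0 _ (Finset.mem_singleton_self _), zero_mul]
  · have h1 := card_bases_filter_insert (C := C) hbE hbB hbC
    have h2 := card_bases_filter_insert (C := C) hbE (Finset.notMem_empty b) hbC
    simp only [Finset.empty_subset, Finset.filter_true, insert_empty_eq] at h2
    unfold baseProb
    rw [h1, h2, div_mul_div_comm, mul_comm, mul_div_mul_right]
    exact (card_bases_pos _ _).ne'

/-- Rayleigh monotonicity: adding edges and contracting edges makes it less likely that a uniform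
spanning forest contains the set `B`. -/
lemma baseProb_anti {C₁ C₂ : Set (Sym2 V)} {E₁ E₂ B : Finset (Sym2 V)} (hC : C₁ ⊆ C₂)
    (hE : E₁ ⊆ E₂) (hB : B ⊆ E₁) : baseProb C₂ E₂ B ≤ baseProb C₁ E₁ B := by
  induction B using Finset.induction_on generalizing C₁ C₂ E₁ E₂ with
  | empty => rw [baseProb_empty, baseProb_empty]
  | insert b B hbB ih =>
    rw [Finset.insert_subset_iff] at hB
    rw [baseProb_insert (hE hB.1) hbB, baseProb_insert hB.1 hbB]
    refine mul_le_mul (baseProb_singleton_anti hC hE hB.1) ?_ (baseProb_nonneg _ _ _)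
      (baseProb_nonneg _ _ _)
    -- Contracting `b` in both graphs preserves the inclusions, and `B` does not contain `b`.
    exact ih (Set.insert_subset_insert hC) (Finset.erase_subset_erase _ hE)
      (Finset.subset_erase.2 ⟨hB.2, hbB⟩)

/-! ### Direct sums, embeddings -/

section DirectSum

variable {κ : Type*} {C : Set (Sym2 V)} {E : Finset (Sym2 V)} {k : Sym2 V → κ}

/-- The hypothesis `hdec` says that spanning only sees edges of the same class, so the matroid is a
direct sum over the classes and its bases are unions of bases of the summands. -/
lemma mem_bases_iff_of_decoupled
    (hdec : ∀ A ⊆ E, ∀ e ∈ E, Spans (C ∪ A) e →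
      Spans (C ∪ (A.filter (k · = k e) : Finset (Sym2 V))) e)
    {I : Finset κ} (hI : ∀ e ∈ E, k e ∈ I) {T : Finset (Sym2 V)} (hTE : T ⊆ E) :
    T ∈ bases C E ↔ ∀ c ∈ I, T.filter (k · = c) ∈ bases C (E.filter (k · = c)) := by
  simp only [mem_bases]
  constructor
  · refine fun h c _ => ⟨Finset.filter_subset_filter _ hTE, fun e he => ?_, fun b hb hs => ?_⟩
    · obtain ⟨heE, rfl⟩ := Finset.mem_filter.1 he
      exact hdec T hTE e heE (h.spans e heE)
    · refine h.indep b (Finset.mem_filter.1 hb).1 (hs.mono (Set.union_subset_union_right C ?_))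
      exact_mod_cast Finset.erase_subset_erase b (Finset.filter_subset _ _)
  · refine fun h => ⟨hTE, fun e he => ?_, fun b hb hs => ?_⟩
    · refine ((h (k e) (hI e he)).spans e (Finset.mem_filter.2 ⟨he, rfl⟩)).mono
        (Set.union_subset_union_right C ?_)
      exact_mod_cast Finset.filter_subset _ _
    · refine (h (k b) (hI b (hTE hb))).indep b (Finset.mem_filter.2 ⟨hb, rfl⟩) ?_
      rw [← Finset.filter_erase]
      exact hdec _ ((Finset.erase_subset _ _).trans hTE) b (hTE hb) hs

lemma card_bases_of_decoupled
    (hdec : ∀ A ⊆ E, ∀ e ∈ E, Spans (C ∪ A) e →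
      Spans (C ∪ (A.filter (k · = k e) : Finset (Sym2 V))) e)
    {I : Finset κ} (hI : ∀ e ∈ E, k e ∈ I) {B : Finset (Sym2 V)} (hB : ∀ b ∈ B, k b ∈ I) :
    ((bases C E).filter (B ⊆ ·)).card =
      ∏ c ∈ I, ((bases C (E.filter (k · = c))).filter (B.filter (k · = c) ⊆ ·)).card := by
  rw [← Finset.card_pi]
  have hkey : ∀ f ∈ I.pi fun c =>
      (bases C (E.filter (k · = c))).filter (B.filter (k · = c) ⊆ ·), ∀ c (hc : c ∈ I),
      (I.attach.biUnion fun c => f c.1 c.2).filter (k · = c) = f c hc := by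
    intro f hf c hc
    rw [Finset.mem_pi] at hf
    have hfk : ∀ c hc, ∀ e ∈ f c hc, k e = c := fun c hc e he =>
      (Finset.mem_filter.1 ((mem_bases.1 (Finset.mem_filter.1 (hf c hc)).1).subset he)).2
    ext e
    simp only [Finset.mem_filter, Finset.mem_biUnion, Finset.mem_attach, true_and, Subtype.exists]
    constructor
    · rintro ⟨⟨c', hc', he⟩, hec⟩
      have := hfk c' hc' e he
      rw [hec] at this
      subst this
      exact he
    · exact fun he => ⟨⟨c, hc, he⟩, hfk c hc e he⟩
  have hsubI : ∀ {A T : Finset (Sym2 V)}, (∀ a ∈ A, k a ∈ I) →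
      (∀ c ∈ I, A.filter (k · = c) ⊆ T.filter (k · = c)) → A ⊆ T := fun hA h a ha =>
    (Finset.mem_filter.1 (h (k a) (hA a ha) (Finset.mem_filter.2 ⟨ha, rfl⟩))).1
  refine Finset.card_bij (fun T _ c _ => T.filter (k · = c)) ?_ ?_ ?_
  · intro T hT
    rw [Finset.mem_filter] at hT
    rw [Finset.mem_pi]
    intro c hc
    rw [Finset.mem_filter]
    exact ⟨(mem_bases_iff_of_decoupled hdec hI (mem_bases.1 hT.1).subset).1 hT.1 c hc,
      Finset.filter_subset_filter _ hT.2⟩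
  · intro T₁ hT₁ T₂ hT₂ heq
    rw [Finset.mem_filter, mem_bases] at hT₁ hT₂
    have h : ∀ c ∈ I, T₁.filter (k · = c) = T₂.filter (k · = c) := fun c hc =>
      congrFun (congrFun heq c) hc
    exact (hsubI (fun a ha => hI a (hT₁.1.subset ha)) fun c hc => (h c hc).subset).antisymm
      (hsubI (fun a ha => hI a (hT₂.1.subset ha)) fun c hc => (h c hc).symm.subset)
  · intro f hf
    have hf' := Finset.mem_pi.1 hf
    refine ⟨I.attach.biUnion fun c => f c.1 c.2, ?_, ?_⟩
    · have hsub : (I.attach.biUnion fun c => f c.1 c.2) ⊆ E := by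
        intro e he
        obtain ⟨c, -, he⟩ := Finset.mem_biUnion.1 he
        exact (Finset.mem_filter.1
          ((mem_bases.1 (Finset.mem_filter.1 (hf' c.1 c.2)).1).subset he)).1
      rw [Finset.mem_filter, mem_bases_iff_of_decoupled hdec hI hsub]
      refine ⟨fun c hc => ?_, hsubI hB fun c hc => ?_⟩
      · rw [hkey f hf c hc]
        exact (Finset.mem_filter.1 (hf' c hc)).1
      · rw [hkey f hf c hc]
        exact (Finset.mem_filter.1 (hf' c hc)).2
    · funext c hc
      exact hkey f hf c hc

/-- The uniform spanning forest of a direct sum is a product. -/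
lemma baseProb_of_decoupled
    (hdec : ∀ A ⊆ E, ∀ e ∈ E, Spans (C ∪ A) e →
      Spans (C ∪ (A.filter (k · = k e) : Finset (Sym2 V))) e)
    {I : Finset κ} (hI : ∀ e ∈ E, k e ∈ I) {B : Finset (Sym2 V)} (hB : ∀ b ∈ B, k b ∈ I) :
    baseProb C E B = ∏ c ∈ I, baseProb C (E.filter (k · = c)) (B.filter (k · = c)) := by
  unfold baseProb
  have h := card_bases_of_decoupled hdec hI (B := ∅) (by simp)
  simp only [Finset.empty_subset, Finset.filter_true, Finset.filter_empty] at h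
  rw [card_bases_of_decoupled hdec hI hB, h, Finset.prod_div_distrib]
  push_cast
  rfl

end DirectSum

/-- Only the relation `Spans` enters the definition of a base, so an edge embedding respecting it
transports bases and hence probabilities. -/
lemma baseProb_map {W : Type*} (j : Sym2 W ↪ Sym2 V) {C : Set (Sym2 W)} {C' : Set (Sym2 V)}
    {E : Finset (Sym2 W)}
    (h : ∀ A ⊆ E, ∀ e ∈ E, Spans (C ∪ A) e ↔ Spans (C' ∪ (A.map j : Finset (Sym2 V))) (j e))
    (B : Finset (Sym2 W)) : baseProb C' (E.map j) (B.map j) = baseProb C E B := by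
  have hb : bases C' (E.map j) = (bases C E).map (Finset.mapEmbedding j).toEmbedding := by
    ext T
    simp only [mem_bases, Finset.mem_map, RelEmbedding.coe_toEmbedding, Finset.mapEmbedding_apply]
    have key : ∀ S : Finset (Sym2 W), S ⊆ E → (IsBase C' (E.map j) (S.map j) ↔ IsBase C E S) := by
      intro S hS
      have h1 : (∀ e ∈ E.map j, Spans (C' ∪ (S.map j : Finset (Sym2 V))) e) ↔
          ∀ e ∈ E, Spans (C ∪ S) e := by
        rw [Finset.forall_mem_map]
        exact forall₂_congr fun e he => (h S hS e he).symm
      have h2 : (∀ b ∈ S.map j, ¬ Spans (C' ∪ ((S.map j).erase b : Finset (Sym2 V))) b) ↔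
          ∀ b ∈ S, ¬ Spans (C ∪ (S.erase b : Finset (Sym2 W))) b := by
        rw [Finset.forall_mem_map]
        refine forall₂_congr fun b hb => ?_
        rw [← Finset.map_erase, h _ ((Finset.erase_subset _ _).trans hS) b (hS hb)]
      exact ⟨fun H => ⟨hS, h1.1 H.spans, h2.1 H.indep⟩,
        fun H => ⟨Finset.map_subset_map.2 hS, h1.2 H.spans, h2.2 H.indep⟩⟩
    constructor
    · intro hT
      obtain ⟨S, hS, rfl⟩ := Finset.subset_map_iff.1 hT.subset
      exact ⟨S, (key S hS).1 hT, rfl⟩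
    · rintro ⟨S, hS, rfl⟩
      exact (key S hS.subset).2 hS
  unfold baseProb
  rw [hb, Finset.filter_map, Finset.card_map, Finset.card_map]
  congr 3
  ext T
  simp

/-! ### Resampling -/

/-- The edges of `D` joining vertices that are connected by the edges of `A`. -/
def closureIn (D A : Finset (Sym2 V)) : Finset (Sym2 V) := D.filter (Spans A ·)

lemma mem_closureIn {D A : Finset (Sym2 V)} {e : Sym2 V} :
    e ∈ closureIn D A ↔ e ∈ D ∧ Spans A e := Finset.mem_filter

section Resampling

variable {C : Set (Sym2 V)} {D E T f : Finset (Sym2 V)}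

lemma IsBase.inter_closureIn (h : IsBase C E T) : IsBase ∅ (closureIn D (T ∩ D)) (T ∩ D) := by
  refine ⟨fun e he => mem_closureIn.2 ⟨(Finset.mem_inter.1 he).2, spans_of_mem he⟩,
    fun e he => ?_, fun b hb hs => ?_⟩
  · rw [Set.empty_union]
    exact (mem_closureIn.1 he).2
  · refine h.indep b (Finset.mem_inter.1 hb).1 (hs.mono ?_)
    rw [Set.empty_union]
    refine subset_trans ?_ Set.subset_union_right
    exact_mod_cast Finset.erase_subset_erase b Finset.inter_subset_left

/-- A replacement forest has the same components inside `D`; the resampling step is therefore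
reversible with equal weights. -/
lemma closureIn_of_isBase (h : IsBase C E T) (hf : IsBase ∅ (closureIn D (T ∩ D)) f) :
    closureIn D f = closureIn D (T ∩ D) := by
  ext e
  rw [mem_closureIn, mem_closureIn]
  refine and_congr_right fun _ => spans_congr (fun a ha => ?_) (fun b hb => ?_) e
  · exact (mem_closureIn.1 (hf.subset ha)).2
  · have := hf.spans b (h.inter_closureIn.subset hb)
    rwa [Set.empty_union] at this

/-- A spanning forest inside `D` may be replaced by any other one with the same components. -/
lemma IsBase.replace (hD : D ⊆ E) (h : IsBase C E T) (hf : IsBase ∅ (closureIn D (T ∩ D)) f) :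
    IsBase C E (f ∪ T \ D) := by
  have hfD : f ⊆ D := hf.subset.trans (Finset.filter_subset _ _)
  have hfT : ∀ e ∈ T ∩ D, Spans (f : Set (Sym2 V)) e := fun e he => by
    have := hf.spans e (h.inter_closureIn.subset he)
    rwa [Set.empty_union] at this
  refine ⟨Finset.union_subset (hfD.trans hD) (Finset.sdiff_subset.trans h.subset),
    fun e he => (h.spans e he).trans ?_, fun b hb => ?_⟩
  · rintro a (ha | ha)
    · exact spans_of_mem (Or.inl ha)
    · by_cases haD : a ∈ D
      · exact (hfT a (Finset.mem_inter.2 ⟨ha, haD⟩)).mono fun x hx => Or.inr (by simp_all)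
      · exact spans_of_mem (Or.inr (by simp_all))
  · rw [Finset.mem_union] at hb
    by_cases hbD : b ∈ D
    · have hbf : b ∈ f := hb.resolve_right fun h' => (Finset.mem_sdiff.1 h').2 hbD
      -- The witness copies the dual potential of `b` in `f` along `T ∩ D` and is flat along `T \
      -- D`. It agrees with that dual potential on `f`, since `T ∩ D` spans `f`.
      set g : V → ℝ := fun v =>
        ∑ a ∈ T, (if a ∈ D then cobd (dualPot ∅ f b) a else 0) * dualPot C T a v with hg
      have hgT : ∀ a ∈ T, cobd g a = if a ∈ D then cobd (dualPot ∅ f b) a else 0 :=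
        fun a ha => h.sum_dualPot_mem _ ha
      have hgf : ∀ a ∈ f, cobd g a = cobd (dualPot ∅ f b) a := by
        intro a ha
        rw [← sub_eq_zero, ← cobd_sub, cobd_eq_zero]
        refine (mem_closureIn.1 (hf.subset ha)).2.constOn _ fun c hc => ?_
        obtain ⟨hcT, hcD⟩ := Finset.mem_inter.1 hc
        rw [← cobd_eq_zero, cobd_sub, hgT c hcT, if_pos hcD, sub_self]
      refine not_spans_of_cobd g ?_ ?_
      · rintro c (hc | hc)
        · exact h.sum_dualPot_contracted _ hc
        · obtain ⟨hcb, hc⟩ := Finset.mem_erase.1 hc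
          by_cases hcf : c ∈ f
          · rw [hgf c hcf, hf.cobd_dualPot_of_ne hbf hcf hcb]
          · obtain ⟨hcT, hcD⟩ := Finset.mem_sdiff.1 ((Finset.mem_union.1 hc).resolve_left hcf)
            rw [hgT c hcT, if_neg hcD]
      · rw [hgf b hbf, hf.cobd_dualPot_self hbf]
        norm_num
    · have hbT : b ∈ T := (Finset.mem_sdiff.1 (hb.resolve_left fun h' => hbD (hfD h'))).1
      refine fun hs => h.indep b hbT (hs.trans ?_)
      rintro a (ha | ha)
      · exact spans_of_mem (Or.inl ha)
      · obtain ⟨hab, ha⟩ := Finset.mem_erase.1 ha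
        rcases Finset.mem_union.1 ha with ha | ha
        · refine (mem_closureIn.1 (hf.subset ha)).2.mono fun x hx => Or.inr ?_
          obtain ⟨hxT, hxD⟩ := Finset.mem_inter.1 hx
          exact Finset.mem_erase.2 ⟨fun hxb => hbD (hxb ▸ hxD), hxT⟩
        · exact spans_of_mem (Or.inr (Finset.mem_erase.2 ⟨hab, (Finset.mem_sdiff.1 ha).1⟩))

/-- Resampling a uniform spanning forest inside `D`, given its components inside `D`, does not
change its law. -/
lemma card_filter_eq_sum_baseProb (C : Set (Sym2 V)) (hD : D ⊆ E) {B : Finset (Sym2 V)}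
    (hB : B ⊆ D) :
    (((bases C E).filter (B ⊆ ·)).card : ℝ) =
      ∑ T ∈ bases C E, baseProb ∅ (closureIn D (T ∩ D)) B := by
  set w : Finset (Sym2 V) → ℝ := fun A => ((bases ∅ (closureIn D A)).card : ℝ)⁻¹ with hw
  have h1 : ∀ T ∈ bases C E, baseProb ∅ (closureIn D (T ∩ D)) B =
      ∑ f ∈ bases ∅ (closureIn D (T ∩ D)), if B ⊆ f then w (T ∩ D) else 0 := by
    intro T _
    rw [← Finset.sum_filter, Finset.sum_const, nsmul_eq_mul]
    exact div_eq_mul_inv _ _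
  have h2 : (((bases C E).filter (B ⊆ ·)).card : ℝ) = ∑ T ∈ bases C E,
      ∑ f ∈ bases ∅ (closureIn D (T ∩ D)), if B ⊆ T then w (T ∩ D) else 0 := by
    rw [Finset.card_filter]
    push_cast
    refine Finset.sum_congr rfl fun T _ => ?_
    rw [Finset.sum_const, nsmul_eq_mul]
    split_ifs
    · exact (mul_inv_cancel₀ (card_bases_pos _ _).ne').symm
    · rw [mul_zero]
  -- Both sides are sums over pairs of a tree `T` and a replacement forest `f`. The involution
  -- swapping `f` with `T ∩ D` preserves the weight and exchanges the conditions `B ⊆ T` and `B ⊆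
  -- f`.
  rw [h2, Finset.sum_congr rfl h1, Finset.sum_sigma', Finset.sum_sigma']
  have hinter : ∀ {T f : Finset (Sym2 V)}, IsBase ∅ (closureIn D (T ∩ D)) f →
      (f ∪ T \ D) ∩ D = f := by
    intro T f hf
    have hfD : f ⊆ D := hf.subset.trans (Finset.filter_subset _ _)
    rw [Finset.union_inter_distrib_right, Finset.sdiff_inter_self, Finset.union_empty,
      Finset.inter_eq_left.2 hfD]
  have hmem : ∀ x ∈ (bases C E).sigma fun T => bases ∅ (closureIn D (T ∩ D)),
      (⟨x.2 ∪ x.1 \ D, x.1 ∩ D⟩ : (_ : Finset (Sym2 V)) × Finset (Sym2 V)) ∈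
        (bases C E).sigma fun T => bases ∅ (closureIn D (T ∩ D)) := by
    rintro ⟨T, f⟩ hx
    simp only [Finset.mem_sigma, mem_bases] at hx ⊢
    refine ⟨hx.1.replace hD hx.2, ?_⟩
    rw [hinter hx.2, closureIn_of_isBase hx.1 hx.2]
    exact hx.1.inter_closureIn
  have hinv : ∀ x ∈ (bases C E).sigma fun T => bases ∅ (closureIn D (T ∩ D)),
      (⟨(x.1 ∩ D) ∪ (x.2 ∪ x.1 \ D) \ D, (x.2 ∪ x.1 \ D) ∩ D⟩ :
        (_ : Finset (Sym2 V)) × Finset (Sym2 V)) = x := by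
    rintro ⟨T, f⟩ hx
    simp only [Finset.mem_sigma, mem_bases] at hx
    have hfD : f ⊆ D := hx.2.subset.trans (Finset.filter_subset _ _)
    have : (T ∩ D) ∪ (f ∪ T \ D) \ D = T := by
      ext e
      have := @hfD e
      simp only [Finset.mem_union, Finset.mem_inter, Finset.mem_sdiff]
      tauto
    simp only [this, hinter hx.2]
  refine Finset.sum_nbij' (fun x => ⟨x.2 ∪ x.1 \ D, x.1 ∩ D⟩) (fun x => ⟨x.2 ∪ x.1 \ D, x.1 ∩ D⟩)
    hmem hmem hinv hinv ?_
  rintro ⟨T, f⟩ hx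
  simp only [Finset.mem_sigma, mem_bases] at hx
  simp only [hinter hx.2, Finset.subset_inter_iff, hB, and_true, hw,
    closureIn_of_isBase hx.1 hx.2]

end Resampling

/-! ### Spanning trees and wired spanning trees as bases -/

lemma constOn_map {X α : Type*} (f : V → X) (g : X → α) (e : Sym2 V) :
    ConstOn g (Sym2.map f e) ↔ ConstOn (g ∘ f) e := by
  induction e with
  | _ u v => rw [Sym2.map_mk, constOn_mk, constOn_mk, Function.comp, Function.comp]

/-- Identifying vertices along `f` is the same as contracting the pairs that `f` collapses: a cut
constant on those pairs descends to the image. -/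
lemma spans_image_iff {X : Type*} (f : V → X) (A : Set (Sym2 V)) (e : Sym2 V) :
    Spans (Sym2.map f '' A) (Sym2.map f e) ↔ Spans ({e | (Sym2.map f e).IsDiag} ∪ A) e := by
  constructor
  · intro h ψ hψ
    have hf : ∀ u v, f u = f v → ψ u = ψ v := fun u v huv =>
      (constOn_mk ψ u v).1 (hψ _ (Or.inl (by simpa using huv)))
    have hcomp : (fun x => ∃ v, f v = x ∧ ψ v) ∘ f = ψ := by
      funext v
      apply propext
      exact ⟨fun ⟨w, hw, hψw⟩ => hf w v hw ▸ hψw, fun hv => ⟨v, rfl, hv⟩⟩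
    have := h (fun x => ∃ v, f v = x ∧ ψ v) ?_
    · rwa [constOn_map, hcomp] at this
    · rintro _ ⟨a, ha, rfl⟩
      rw [constOn_map, hcomp]
      exact hψ a (Or.inr ha)
  · intro h ψ hψ
    rw [constOn_map]
    refine h _ ?_
    rintro a (ha | ha)
    · induction a with
      | _ u v =>
        rw [constOn_mk]
        simp only [Set.mem_ofPred_eq, Sym2.map_mk, Sym2.mk_isDiag_iff] at ha
        simp [ha]
    · rw [← constOn_map]
      exact hψ _ ⟨a, ha, rfl⟩

lemma spans_image_iff_of_injective {X : Type*} {f : V → X} (hf : Function.Injective f)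
    (A : Set (Sym2 V)) (e : Sym2 V) :
    Spans (Sym2.map f '' A) (Sym2.map f e) ↔ Spans A e := by
  rw [spans_image_iff]
  refine spans_congr ?_ (fun b hb => spans_of_mem (Or.inr hb)) e
  rintro a (ha | ha)
  · exact spans_of_isDiag ((Sym2.isDiag_map hf).1 ha)
  · exact spans_of_mem ha

/-- The decisive cut is the set of vertices reachable from `u`. -/
lemma reachable_iff_spans (T : SimpleGraph V) (u v : V) :
    T.Reachable u v ↔ Spans T.edgeSet s(u, v) := by
  constructor
  · rintro ⟨p⟩ ψ hψ
    rw [constOn_mk]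
    induction p with
    | nil => rfl
    | cons h p ih => exact ((constOn_mk ψ _ _).1 (hψ _ h)).trans ih
  · intro h
    have := h (T.Reachable u) fun a ha => by
      induction a with
      | _ x y =>
        rw [constOn_mk]
        exact propext ⟨fun hx => hx.trans (SimpleGraph.Adj.reachable ha),
          fun hy => hy.trans (SimpleGraph.Adj.reachable ha).symm⟩
    rw [constOn_mk] at this
    exact this.mp (SimpleGraph.Reachable.refl u)

lemma isTree_iff_spans (T : SimpleGraph V) : T.IsTree ↔ Nonempty V ∧
    (∀ u v, Spans T.edgeSet s(u, v)) ∧ ∀ e ∈ T.edgeSet, ¬ Spans (T.edgeSet \ {e}) e := by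
  rw [SimpleGraph.isTree_iff, SimpleGraph.connected_iff, SimpleGraph.isAcyclic_iff_forall_isBridge,
    and_comm (a := T.Preconnected), and_assoc]
  refine and_congr_right fun _ => and_congr ?_ ?_
  · exact forall₂_congr fun u v => reachable_iff_spans T u v
  · refine forall₂_congr fun e _ => ?_
    induction e with
    | _ u v =>
      rw [SimpleGraph.isBridge_iff, reachable_iff_spans, SimpleGraph.edgeSet_deleteEdges]

/-- The graph with edge set a given finite set. -/
abbrev graphOf (A : Finset (Sym2 V)) : SimpleGraph V := SimpleGraph.fromEdgeSet (A : Set (Sym2 V))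

lemma edgeSet_graphOf {G : SimpleGraph V} {A : Finset (Sym2 V)}
    (hA : (A : Set (Sym2 V)) ⊆ G.edgeSet) : (graphOf A).edgeSet = A := by
  rw [SimpleGraph.edgeSet_fromEdgeSet]
  refine Disjoint.sdiff_eq_left ?_
  exact Set.disjoint_left.2 fun e he hd => G.not_isDiag_of_mem_edgeSet (hA he) hd

lemma isTree_induce_iff {S : Set V} (hS : S.Nonempty) {T : SimpleGraph V}
    (hT : ∀ u v, T.Adj u v → u ∈ S ∧ v ∈ S) : (T.induce S).IsTree ↔
    (∀ u ∈ S, ∀ v ∈ S, Spans T.edgeSet s(u, v)) ∧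
      ∀ e ∈ T.edgeSet, ¬ Spans (T.edgeSet \ {e}) e := by
  have himg : Sym2.map (Subtype.val : S → V) '' (T.induce S).edgeSet = T.edgeSet := by
    ext e
    constructor
    · rintro ⟨a, ha, rfl⟩
      induction a with
      | _ u v => exact ha
    · intro he
      induction e with
      | _ u v => exact ⟨s(⟨u, (hT u v he).1⟩, ⟨v, (hT u v he).2⟩), he, rfl⟩
  have hinj : Function.Injective (Sym2.map (Subtype.val : S → V)) :=
    Sym2.map.injective Subtype.val_injective
  rw [isTree_iff_spans]
  have : Nonempty S := hS.to_subtype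
  simp only [this, true_and]
  refine and_congr ?_ ?_
  · rw [Subtype.forall]
    refine forall₂_congr fun u hu => ?_
    rw [Subtype.forall]
    refine forall₂_congr fun v hv => ?_
    rw [← spans_image_iff_of_injective Subtype.val_injective, himg]
    rfl
  · rw [← himg, Set.forall_mem_image]
    refine forall₂_congr fun e _ => ?_
    rw [← spans_image_iff_of_injective Subtype.val_injective, Set.image_sdiff hinj,
      Set.image_singleton]

/-- Connectedness of `H` turns maximal spanning forests into spanning trees. -/
lemma mem_spanningTrees_iff {G : SimpleGraph V} {H : G.Subgraph} (hH : H.Connected)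
    {E : Finset (Sym2 V)} (hE : (E : Set (Sym2 V)) = H.edgeSet) (T : SimpleGraph V) :
    T ∈ spanningTrees H ↔ ∃ A ∈ bases ∅ E, graphOf A = T := by
  have hEG : (E : Set (Sym2 V)) ⊆ G.edgeSet := hE ▸ H.edgeSet_subset
  have hHspan : ∀ u ∈ H.verts, ∀ v ∈ H.verts, Spans (E : Set (Sym2 V)) s(u, v) := by
    intro u hu v hv
    have h1 := (reachable_iff_spans H.coe ⟨u, hu⟩ ⟨v, hv⟩).1
      ((SimpleGraph.Subgraph.connected_iff'.1 hH).preconnected _ _)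
    rw [← spans_image_iff_of_injective Subtype.val_injective] at h1
    refine h1.mono ?_
    rw [hE]
    rintro _ ⟨a, ha, rfl⟩
    induction a with
    | _ x y => exact ha
  have key : ∀ A : Finset (Sym2 V), A ⊆ E → (graphOf A ∈ spanningTrees H ↔ IsBase ∅ E A) := by
    intro A hA
    have hAE : (graphOf A).edgeSet = A := edgeSet_graphOf ((Finset.coe_subset.2 hA).trans hEG)
    have hle : graphOf A ≤ H.spanningCoe := by
      rw [← SimpleGraph.edgeSet_subset_edgeSet, hAE]
      refine (Finset.coe_subset.2 hA).trans ?_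
      rw [hE, SimpleGraph.Subgraph.edgeSet_spanningCoe]
    have hadj : ∀ u v, (graphOf A).Adj u v → u ∈ H.verts ∧ v ∈ H.verts := fun u v huv =>
      ⟨(hle huv).fst_mem, (hle huv).snd_mem⟩
    have h1 : graphOf A ∈ spanningTrees H ↔ ((graphOf A).induce H.verts).IsTree :=
      ⟨fun h => h.2, fun h => ⟨hle, h⟩⟩
    rw [h1, isTree_induce_iff (SimpleGraph.Subgraph.connected_iff.1 hH).2 hadj, hAE]
    constructor
    · refine fun h => ⟨hA, fun e he => ?_, fun b hb => ?_⟩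
      · rw [Set.empty_union]
        have he' : e ∈ H.edgeSet := hE ▸ (Finset.mem_coe.2 he)
        induction e with
        | _ u v => exact h.1 u (H.edge_vert he') v (H.edge_vert he'.symm)
      · rw [Set.empty_union, Finset.coe_erase]
        exact h.2 b hb
    · refine fun h => ⟨fun u hu v hv => (hHspan u hu v hv).trans fun e he => ?_, fun e he => ?_⟩
      · have := h.spans e he
        rwa [Set.empty_union] at this
      · have := h.indep e he
        rwa [Set.empty_union, Finset.coe_erase] at this
  constructor
  · intro hT
    have hTE : T.edgeSet ⊆ E := by
      rw [hE, ← SimpleGraph.Subgraph.edgeSet_spanningCoe]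
      exact SimpleGraph.edgeSet_subset_edgeSet.2 hT.1
    obtain ⟨A, hA⟩ := (E.finite_toSet.subset hTE).exists_finset_coe
    have hAT : graphOf A = T := by
      unfold graphOf
      rw [hA, SimpleGraph.fromEdgeSet_edgeSet]
    have hAE : A ⊆ E := by rw [← Finset.coe_subset, hA]; exact hTE
    exact ⟨A, mem_bases.2 ((key A hAE).1 (hAT ▸ hT)), hAT⟩
  · rintro ⟨A, hA, rfl⟩
    rw [mem_bases] at hA
    exact (key A hA.subset).2 hA

/-- The pairs of vertices outside `S`. -/
def outsidePairs (S : Set V) : Set (Sym2 V) := {e | ∀ v ∈ e, v ∉ S}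

lemma outsidePairs_anti {S S' : Set V} (h : S ⊆ S') : outsidePairs S' ⊆ outsidePairs S :=
  fun _ he v hv hvS => he v hv (h hvS)

lemma wire_eq_iff {S : Set V} {u v : V} : wire S u = wire S v ↔ u = v ∨ (u ∉ S ∧ v ∉ S) := by
  unfold wire
  exact Quotient.eq (r := wiredSetoid S)

lemma isDiag_map_wire {S : Set V} {e : Sym2 V} :
    (Sym2.map (wire S) e).IsDiag ↔ e.IsDiag ∨ e ∈ outsidePairs S := by
  induction e with
  | _ u v => simp [wire_eq_iff, outsidePairs]

lemma spans_image_wire {S : Set V} (A : Set (Sym2 V)) (e : Sym2 V) :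
    Spans (Sym2.map (wire S) '' A) (Sym2.map (wire S) e) ↔ Spans (outsidePairs S ∪ A) e := by
  rw [spans_image_iff]
  refine spans_congr ?_ ?_ e
  · rintro a (ha | ha)
    · rcases isDiag_map_wire.1 ha with h | h
      · exact spans_of_isDiag h
      · exact spans_of_mem (Or.inl h)
    · exact spans_of_mem (Or.inr ha)
  · rintro a (ha | ha)
    · exact spans_of_mem (Or.inl (isDiag_map_wire.2 (Or.inr ha)))
    · exact spans_of_mem (Or.inr ha)

lemma edgeSet_map_of_ne {X : Type*} {f : V → X} {T : SimpleGraph V}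
    (h : ∀ u v, T.Adj u v → f u ≠ f v) : (T.map f).edgeSet = Sym2.map f '' T.edgeSet := by
  ext e
  constructor
  · intro he
    induction e with
    | _ x y =>
      obtain ⟨-, u, v, huv, rfl, rfl⟩ := he
      exact ⟨s(u, v), huv, rfl⟩
  · rintro ⟨a, ha, rfl⟩
    induction a with
    | _ u v => exact ⟨h u v ha, u, v, ha, rfl, rfl⟩

/-- Edges with both ends outside `S` are exactly the loops of the wired multigraph and may be
dropped. The absence of loops and parallel edges in a base follows from independence, as parallel
edges span each other. -/
lemma mem_wiredSpanningTrees_iff {G : SimpleGraph V} (hG : G.Connected) {S : Set V}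
    {E : Finset (Sym2 V)} (hE : (E : Set (Sym2 V)) = G.edgeSet \ outsidePairs S)
    (T : SimpleGraph V) :
    T ∈ wiredSpanningTrees G S ↔ ∃ A ∈ bases (outsidePairs S) E, graphOf A = T := by
  have hEG : (E : Set (Sym2 V)) ⊆ G.edgeSet := hE ▸ Set.sdiff_subset
  constructor
  · rintro ⟨hTG, hloop, hinj, htree⟩
    have hTE : T.edgeSet ⊆ E := by
      rw [hE]
      refine fun e he => ⟨SimpleGraph.edgeSet_subset_edgeSet.2 hTG he, fun ho => ?_⟩
      induction e with
      | _ u v =>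
        exact hloop u v he (wire_eq_iff.2 (Or.inr ⟨ho u (Sym2.mem_mk_left _ _),
          ho v (Sym2.mem_mk_right _ _)⟩))
    obtain ⟨A, hA⟩ := (E.finite_toSet.subset hTE).exists_finset_coe
    have hAT : graphOf A = T := by
      unfold graphOf
      rw [hA, SimpleGraph.fromEdgeSet_edgeSet]
    have hAE : A ⊆ E := by rw [← Finset.coe_subset, hA]; exact hTE
    rw [isTree_iff_spans, edgeSet_map_of_ne hloop, Set.forall_mem_image] at htree
    refine ⟨A, mem_bases.2 ⟨hAE, fun e _ => ?_, fun b hb => ?_⟩, hAT⟩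
    · rw [hA, ← spans_image_wire]
      induction e with
      | _ u v => exact htree.2.1 _ _
    · have hbT : b ∈ T.edgeSet := hA ▸ hb
      rw [Finset.coe_erase, hA, ← spans_image_wire, hinj.image_sdiff_subset
        (Set.singleton_subset_iff.2 hbT), Set.image_singleton]
      exact htree.2.2 hbT
  · rintro ⟨A, hA, rfl⟩
    rw [mem_bases] at hA
    have hAE : (graphOf A).edgeSet = A :=
      edgeSet_graphOf ((Finset.coe_subset.2 hA.subset).trans hEG)
    have hindep : ∀ e ∈ A, ¬ Spans (Sym2.map (wire S) '' ((A : Set (Sym2 V)) \ {e}))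
        (Sym2.map (wire S) e) := by
      intro e he
      rw [spans_image_wire, ← Finset.coe_erase]
      exact hA.indep e he
    have hloop : ∀ u v, (graphOf A).Adj u v → wire S u ≠ wire S v := by
      intro u v huv heq
      have he : s(u, v) ∈ A := by
        rw [← Finset.mem_coe, ← hAE]
        exact huv
      exact hindep _ he (spans_of_isDiag (by simpa using heq))
    have hinj : Set.InjOn (Sym2.map (wire S)) (A : Set (Sym2 V)) := by
      intro a ha b hb hab
      by_contra hne
      exact hindep a ha (spans_of_mem ⟨b, ⟨hb, fun h => hne h.symm⟩, hab.symm⟩)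
    refine ⟨?_, hloop, hAE ▸ hinj, ?_⟩
    · rw [← SimpleGraph.edgeSet_subset_edgeSet, hAE]
      exact (Finset.coe_subset.2 hA.subset).trans hEG
    · rw [isTree_iff_spans, edgeSet_map_of_ne hloop, hAE, Set.forall_mem_image]
      refine ⟨hG.nonempty.map (wire S), fun x y => ?_, fun b hb => ?_⟩
      · obtain ⟨u, rfl⟩ := Quotient.exists_rep x
        obtain ⟨v, rfl⟩ := Quotient.exists_rep y
        have := (spans_image_wire (S := S) (A : Set (Sym2 V)) s(u, v)).2
          (((reachable_iff_spans G u v).1 (hG.preconnected u v)).trans fun e he => ?_)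
        · exact this
        · by_cases ho : e ∈ outsidePairs S
          · exact spans_of_mem (Or.inl ho)
          · exact hA.spans e (by rw [← Finset.mem_coe, hE]; exact ⟨he, ho⟩)
      · have := hindep b hb
        rwa [hinj.image_sdiff_subset (Set.singleton_subset_iff.2 hb),
          Set.image_singleton] at this

/-! ### Uniform measures on bases -/

lemma graphOf_injOn {G : SimpleGraph V} {C : Set (Sym2 V)} {E : Finset (Sym2 V)}
    (hE : (E : Set (Sym2 V)) ⊆ G.edgeSet) :
    Set.InjOn graphOf (bases C E : Set (Finset (Sym2 V))) := by
  intro A hA B hB hAB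
  have h1 := edgeSet_graphOf ((Finset.coe_subset.2 (mem_bases.1 hA).subset).trans hE)
  have h2 := edgeSet_graphOf ((Finset.coe_subset.2 (mem_bases.1 hB).subset).trans hE)
  rw [← Finset.coe_inj, ← h1, ← h2, hAB]

lemma uniformProb_eq {G : SimpleGraph V} {C : Set (Sym2 V)} {E : Finset (Sym2 V)}
    (hE : (E : Set (Sym2 V)) ⊆ G.edgeSet) {𝒯 : Set (SimpleGraph V)}
    (h𝒯 : ∀ T, T ∈ 𝒯 ↔ ∃ A ∈ bases C E, graphOf A = T) (𝒜 : Set (SimpleGraph V)) :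
    uniformProb 𝒯 𝒜 =
      (((bases C E).filter (graphOf · ∈ 𝒜)).card : ℝ) / ((bases C E).card : ℝ) := by
  have h1 : 𝒯 = graphOf '' (bases C E : Set (Finset (Sym2 V))) := Set.ext h𝒯
  have h2 : 𝒯 ∩ 𝒜 = graphOf '' ((bases C E).filter (graphOf · ∈ 𝒜) : Set (Finset (Sym2 V))) := by
    ext T
    simp only [Set.mem_inter_iff, h𝒯, Set.mem_image, Finset.mem_coe, Finset.mem_filter]
    constructor
    · rintro ⟨⟨A, hA, rfl⟩, hT⟩
      exact ⟨A, ⟨hA, hT⟩, rfl⟩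
    · rintro ⟨A, ⟨hA, hT⟩, rfl⟩
      exact ⟨⟨A, hA, rfl⟩, hT⟩
  unfold uniformProb
  rw [h2, ((graphOf_injOn hE).mono
    (Finset.coe_subset.2 (Finset.filter_subset _ _))).ncard_image, h1,
    (graphOf_injOn hE).ncard_image, Set.ncard_coe_finset, Set.ncard_coe_finset]

/-- The event that all pairs in `B` are edges. -/
def upperEvent (B : Finset (Sym2 V)) : Set (SimpleGraph V) := {T | (B : Set (Sym2 V)) ⊆ T.edgeSet}

lemma uniformProb_upperEvent {G : SimpleGraph V} {C : Set (Sym2 V)} {E : Finset (Sym2 V)}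
    (hE : (E : Set (Sym2 V)) ⊆ G.edgeSet) {𝒯 : Set (SimpleGraph V)}
    (h𝒯 : ∀ T, T ∈ 𝒯 ↔ ∃ A ∈ bases C E, graphOf A = T) (B : Finset (Sym2 V)) :
    uniformProb 𝒯 (upperEvent B) = baseProb C E B := by
  rw [uniformProb_eq hE h𝒯, baseProb]
  congr 3
  refine Finset.filter_congr fun A hA => ?_
  unfold upperEvent
  rw [Set.mem_ofPred_eq, edgeSet_graphOf ((Finset.coe_subset.2 (mem_bases.1 hA).subset).trans hE),
    Finset.coe_subset]

/-! ### Exhaustions -/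

/-- Balls around `o`. -/
def gball (G : SimpleGraph V) (o : V) : ℕ → Set V
  | 0 => {o}
  | n + 1 => gball G o n ∪ {w | ∃ v ∈ gball G o n, G.Adj v w}

lemma gball_mono (G : SimpleGraph V) (o : V) : Monotone (gball G o) :=
  monotone_nat_of_le_succ fun _ => Set.subset_union_left

lemma gball_finite {G : SimpleGraph V} (hfin : ∀ v, (G.neighborSet v).Finite) (o : V) (n : ℕ) :
    (gball G o n).Finite := by
  induction n with
  | zero => exact Set.finite_singleton o
  | succ n ih =>
    refine ih.union ((ih.biUnion fun v _ => hfin v).subset ?_)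
    rintro w ⟨v, hv, hvw⟩
    exact Set.mem_biUnion hv hvw

lemma exists_mem_gball {G : SimpleGraph V} (hG : G.Connected) (o v : V) : ∃ n, v ∈ gball G o n := by
  obtain ⟨p⟩ := hG.preconnected v o
  induction p with
  | nil => exact ⟨0, rfl⟩
  | cons h p ih =>
    obtain ⟨n, hn⟩ := ih
    exact ⟨n + 1, Or.inr ⟨_, hn, h.symm⟩⟩

lemma countable_of_connected {G : SimpleGraph V} (hG : G.Connected)
    (hfin : ∀ v, (G.neighborSet v).Finite) : Countable V := by
  obtain ⟨o⟩ := hG.nonempty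
  rw [← Set.countable_univ_iff]
  refine (Set.countable_iUnion fun n => (gball_finite hfin o n).countable).mono fun v _ => ?_
  exact Set.mem_iUnion.2 (exists_mem_gball hG o v)

lemma gball_connected (G : SimpleGraph V) (o : V) (n : ℕ) :
    ((⊤ : G.Subgraph).induce (gball G o n)).Connected := by
  have ho : ∀ m, o ∈ gball G o m := fun m => gball_mono G o (Nat.zero_le m) rfl
  have key : ∀ m, ∀ hmn : m ≤ n, ∀ v (hv : v ∈ gball G o m),
      (G.induce (gball G o n)).Reachable ⟨o, ho n⟩ ⟨v, gball_mono G o hmn hv⟩ := by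
    intro m
    induction m with
    | zero =>
      rintro hmn v rfl
      exact SimpleGraph.Reachable.refl _
    | succ m ih =>
      rintro hmn v (hv | ⟨w, hw, hwv⟩)
      · exact ih (by omega) v hv
      · refine (ih (by omega) w hw).trans (SimpleGraph.Adj.reachable ?_)
        exact hwv
  rw [← SimpleGraph.connected_induce_iff, SimpleGraph.connected_iff]
  refine ⟨fun u v => ?_, ⟨⟨o, ho n⟩⟩⟩
  exact (key n le_rfl u u.2).symm.trans (key n le_rfl v v.2)

/-- Balls give an exhaustion, so the definitions of the two forest measures are not vacuous. -/
lemma exists_isExhaustion {G : SimpleGraph V} (hG : G.Connected)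
    (hfin : ∀ v, (G.neighborSet v).Finite) :
    ∃ Gn : ℕ → G.Subgraph, IsExhaustion Gn ∧ ∀ n, (Gn n).IsInduced := by
  obtain ⟨o⟩ := hG.nonempty
  refine ⟨fun n => (⊤ : G.Subgraph).induce (gball G o n), ⟨fun n => gball_finite hfin o n,
    gball_connected G o, fun m n hmn => ?_, ?_⟩, fun n u hu v hv huv => ⟨hu, hv, huv⟩⟩
  · exact SimpleGraph.Subgraph.induce_mono_right (gball_mono G o hmn)
  · refine le_antisymm le_top ⟨fun v _ => ?_, fun u v huv => ?_⟩
    · rw [SimpleGraph.Subgraph.verts_iSup, Set.mem_iUnion]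
      exact exists_mem_gball hG o v
    · rw [SimpleGraph.Subgraph.iSup_adj]
      obtain ⟨m, hm⟩ := exists_mem_gball hG o u
      obtain ⟨n, hn⟩ := exists_mem_gball hG o v
      exact ⟨max m n, gball_mono G o (le_max_left m n) hm,
        gball_mono G o (le_max_right m n) hn, huv⟩

namespace IsExhaustion

variable {G : SimpleGraph V} {Gn : ℕ → G.Subgraph}

lemma eventually_mem_verts (h : IsExhaustion Gn) (v : V) : ∀ᶠ n in atTop, v ∈ (Gn n).verts := by
  have hv : v ∈ (⨆ n, Gn n).verts := h.iSup_eq_top ▸ Set.mem_univ v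
  rw [SimpleGraph.Subgraph.verts_iSup, Set.mem_iUnion] at hv
  obtain ⟨m, hm⟩ := hv
  filter_upwards [eventually_ge_atTop m] with n hn
  exact (h.mono hn).1 hm

lemma eventually_mem_edgeSet (h : IsExhaustion Gn) {e : Sym2 V} (he : e ∈ G.edgeSet) :
    ∀ᶠ n in atTop, e ∈ (Gn n).edgeSet := by
  induction e with
  | _ u v =>
    have huv : (⨆ n, Gn n).Adj u v := h.iSup_eq_top ▸ he
    rw [SimpleGraph.Subgraph.iSup_adj] at huv
    obtain ⟨m, hm⟩ := huv
    filter_upwards [eventually_ge_atTop m] with n hn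
    exact (h.mono hn).2 hm

lemma finite_edgeSet (h : IsExhaustion Gn) (n : ℕ) : (Gn n).edgeSet.Finite := by
  have : Finite (Gn n).verts := h.finite n
  have hf : (Sym2.map Subtype.val '' (Set.univ : Set (Sym2 (Gn n).verts))).Finite :=
    Set.toFinite _
  refine hf.subset fun e he => ?_
  induction e with
  | _ u v =>
    exact ⟨s(⟨u, (Gn n).edge_vert he⟩, ⟨v, (Gn n).edge_vert (SimpleGraph.Subgraph.Adj.symm he)⟩),
      trivial, rfl⟩

end IsExhaustion

/-! ### Limits of finite-volume probabilities -/

lemma eventually_subset_of_forall {ι α : Type*} {l : Filter ι} {E : ι → Finset α} {B : Finset α}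
    (h : ∀ b ∈ B, ∀ᶠ n in l, b ∈ E n) : ∀ᶠ n in l, B ⊆ E n :=
  (Filter.eventually_all_finset B).2 h

/-- The probability that the free spanning forest of `G` contains `B`. -/
def freeProb (G : SimpleGraph V) (B : Finset (Sym2 V)) : ℝ :=
  if (B : Set (Sym2 V)) ⊆ G.edgeSet then
    ⨅ E : {E : Finset (Sym2 V) // B ⊆ E ∧ (E : Set (Sym2 V)) ⊆ G.edgeSet}, baseProb ∅ E B
  else 0

/-- By Rayleigh monotonicity every large `E n` has a value between the infimum and that of a nearly
optimal set. Neither monotonicity nor connectedness of `E n` is needed, so the lemma also serves for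
random closures and for disconnected graphs. -/
lemma tendsto_freeProb {G : SimpleGraph V} {E : ℕ → Finset (Sym2 V)}
    (hEG : ∀ n, (E n : Set (Sym2 V)) ⊆ G.edgeSet)
    (hE : ∀ e ∈ G.edgeSet, ∀ᶠ n in atTop, e ∈ E n) (B : Finset (Sym2 V)) :
    Tendsto (fun n => baseProb ∅ (E n) B) atTop (𝓝 (freeProb G B)) := by
  unfold freeProb
  split_ifs with hB
  · have hBE : ∀ A : Finset (Sym2 V), (A : Set (Sym2 V)) ⊆ G.edgeSet → ∀ᶠ n in atTop, A ⊆ E n :=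
      fun A hA => eventually_subset_of_forall fun a ha => hE a (hA ha)
    have : Nonempty {E : Finset (Sym2 V) // B ⊆ E ∧ (E : Set (Sym2 V)) ⊆ G.edgeSet} :=
      ⟨⟨B, subset_rfl, hB⟩⟩
    have hbdd : BddBelow (Set.range fun E : {E : Finset (Sym2 V) //
        B ⊆ E ∧ (E : Set (Sym2 V)) ⊆ G.edgeSet} => baseProb ∅ (E : Finset (Sym2 V)) B) :=
      ⟨0, by rintro _ ⟨A, rfl⟩; exact baseProb_nonneg _ _ _⟩
    rw [tendsto_order]
    constructor
    · intro a ha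
      filter_upwards [hBE B hB] with n hn
      exact ha.trans_le (ciInf_le hbdd ⟨E n, hn, hEG n⟩)
    · intro a ha
      obtain ⟨A, hA⟩ := exists_lt_of_ciInf_lt ha
      filter_upwards [hBE A A.2.2] with n hn
      exact (baseProb_anti subset_rfl hn A.2.1).trans_lt hA
  · refine tendsto_const_nhds.congr fun n => ?_
    exact (baseProb_eq_zero fun h => hB ((Finset.coe_subset.2 h).trans (hEG n))).symm

/-- The additional edges are contracted, hence loops, and no base contains a loop. -/
lemma bases_congr_of_subset {C : Set (Sym2 V)} {E E' : Finset (Sym2 V)} (hE : E ⊆ E')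
    (hC : ∀ e ∈ E', e ∉ E → e ∈ C) : bases C E = bases C E' := by
  ext T
  rw [mem_bases, mem_bases]
  constructor
  · refine fun h => ⟨h.subset.trans hE, fun e he => ?_, h.indep⟩
    by_cases heE : e ∈ E
    · exact h.spans e heE
    · exact spans_of_mem (Or.inl (hC e he heE))
  · refine fun h => ⟨fun e he => ?_, fun e he => h.spans e (hE he), h.indep⟩
    by_contra heE
    exact h.not_spans he (spans_of_mem (hC e (h.subset he) heE))

/-- The edges of `G` with at least one endpoint in the finite set `S`. -/
def touching (G : SimpleGraph V) (S : Set V) : Finset (Sym2 V) :=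
  if h : (G.edgeSet \ outsidePairs S).Finite then h.toFinset else ∅

lemma coe_touching {G : SimpleGraph V} (hfin : ∀ v, (G.neighborSet v).Finite) {S : Set V}
    (hS : S.Finite) : (touching G S : Set (Sym2 V)) = G.edgeSet \ outsidePairs S := by
  have h : (G.edgeSet \ outsidePairs S).Finite := by
    refine (hS.biUnion fun v _ => (hfin v).image fun w => s(v, w)).subset ?_
    rintro e ⟨he, ho⟩
    simp only [outsidePairs, Set.mem_ofPred_eq, not_forall, not_not] at ho
    obtain ⟨v, hv, hvS⟩ := ho
    obtain ⟨w, rfl⟩ := Sym2.mem_iff_exists.1 hv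
    exact Set.mem_biUnion hvS ⟨w, he, rfl⟩
  unfold touching
  rw [dif_pos h, Set.Finite.coe_toFinset]

lemma mem_touching {G : SimpleGraph V} (hfin : ∀ v, (G.neighborSet v).Finite) {S : Set V}
    (hS : S.Finite) {e : Sym2 V} : e ∈ touching G S ↔ e ∈ G.edgeSet ∧ e ∉ outsidePairs S := by
  rw [← Finset.mem_coe, coe_touching hfin hS, Set.mem_sdiff]

lemma coe_touching_subset (G : SimpleGraph V) (S : Set V) :
    (touching G S : Set (Sym2 V)) ⊆ G.edgeSet := by
  unfold touching
  split_ifs with h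
  · rw [Set.Finite.coe_toFinset]
    exact Set.sdiff_subset
  · simp

/-- The probability that `B` is contained in a uniform spanning tree of `G` with the outside of
`S` identified to a single vertex. -/
def wiredBaseProb (G : SimpleGraph V) (S : Set V) (B : Finset (Sym2 V)) : ℝ :=
  baseProb (outsidePairs S) (touching G S) B

/-- The edges that touch `S'` but not `S` are loops when the outside of `S` is contracted, so both
models may use the edges touching `S'`. Enlarging `S` then only removes contractions. -/
lemma wiredBaseProb_mono {G : SimpleGraph V} (hfin : ∀ v, (G.neighborSet v).Finite) {S S' : Set V}
    (hS' : S'.Finite) (hSS' : S ⊆ S') (B : Finset (Sym2 V)) :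
    wiredBaseProb G S B ≤ wiredBaseProb G S' B := by
  have hS := hS'.subset hSS'
  have hsub : touching G S ⊆ touching G S' := fun e he => by
    rw [mem_touching hfin hS] at he
    rw [mem_touching hfin hS']
    exact ⟨he.1, fun h => he.2 (outsidePairs_anti hSS' h)⟩
  by_cases hB : B ⊆ touching G S
  · unfold wiredBaseProb
    have : baseProb (outsidePairs S) (touching G S) B =
        baseProb (outsidePairs S) (touching G S') B := by
      unfold baseProb
      rw [bases_congr_of_subset hsub]
      intro e he heS
      rw [mem_touching hfin hS] at heS
      rw [mem_touching hfin hS'] at he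
      by_contra h
      exact heS ⟨he.1, h⟩
    rw [this]
    exact baseProb_anti (outsidePairs_anti hSS') subset_rfl (hB.trans hsub)
  · rw [wiredBaseProb, baseProb_eq_zero hB]
    exact baseProb_nonneg _ _ _

/-- The probability that the wired spanning forest of `G` contains `B`. -/
def wiredProb (G : SimpleGraph V) (B : Finset (Sym2 V)) : ℝ :=
  ⨆ S : Finset V, wiredBaseProb G (S : Set V) B

lemma bddAbove_wiredBaseProb (G : SimpleGraph V) (B : Finset (Sym2 V)) :
    BddAbove (Set.range fun S : Finset V => wiredBaseProb G (S : Set V) B) :=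
  ⟨1, by rintro _ ⟨S, rfl⟩; exact baseProb_le_one _ _ _⟩

lemma tendsto_wiredProb {G : SimpleGraph V} (hfin : ∀ v, (G.neighborSet v).Finite)
    {S : ℕ → Set V} (hS : ∀ n, (S n).Finite) (hcover : ∀ v, ∀ᶠ n in atTop, v ∈ S n)
    (B : Finset (Sym2 V)) :
    Tendsto (fun n => wiredBaseProb G (S n) B) atTop (𝓝 (wiredProb G B)) := by
  unfold wiredProb
  rw [tendsto_order]
  constructor
  · intro a ha
    obtain ⟨A, hA⟩ := exists_lt_of_lt_ciSup ha
    filter_upwards [(Filter.eventually_all_finset A).2 fun v _ => hcover v] with n hn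
    exact hA.trans_le (wiredBaseProb_mono hfin (hS n) hn B)
  · intro a ha
    refine Eventually.of_forall fun n => lt_of_le_of_lt ?_ ha
    have := le_ciSup (bddAbove_wiredBaseProb G B) (hS n).toFinset
    rwa [Set.Finite.coe_toFinset] at this

/-- The wired spanning forest is dominated by the free spanning forest. -/
lemma wiredProb_le_freeProb {G : SimpleGraph V} (hfin : ∀ v, (G.neighborSet v).Finite)
    (B : Finset (Sym2 V)) : wiredProb G B ≤ freeProb G B := by
  refine ciSup_le fun S => ?_
  have hS := S.finite_toSet
  unfold freeProb
  split_ifs with hB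
  · have : Nonempty {E : Finset (Sym2 V) // B ⊆ E ∧ (E : Set (Sym2 V)) ⊆ G.edgeSet} :=
      ⟨⟨B, subset_rfl, hB⟩⟩
    refine le_ciInf fun E => ?_
    obtain ⟨E, hBE, hE⟩ := E
    -- Adding all endpoints of `E` to `S` makes every edge of `E` touch the set, so that the wired
    -- model has more edges and more contractions than the free one.
    have hfinV : {v | ∃ e ∈ E, v ∈ e}.Finite := by
      have : {v | ∃ e ∈ E, v ∈ e} = ⋃ e ∈ E, (e : Set V) := by ext; simp
      rw [this]
      refine E.finite_toSet.biUnion fun e _ => ?_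
      induction e with
      | _ u v => exact (Set.toFinite {u, v}).subset fun x hx => by simpa using hx
    refine (wiredBaseProb_mono hfin (hS.union hfinV) Set.subset_union_left B).trans ?_
    refine baseProb_anti (Set.empty_subset _) (fun e he => ?_) hBE
    rw [mem_touching hfin (hS.union hfinV)]
    refine ⟨hE he, fun ho => ?_⟩
    exact ho _ (Sym2.out_fst_mem e) (Or.inr ⟨e, he, Sym2.out_fst_mem e⟩)
  · unfold wiredBaseProb
    rw [baseProb_eq_zero]
    exact fun h => hB ((Finset.coe_subset.2 h).trans (coe_touching_subset G S))

/-! ### Events and weak limits -/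

lemma measurableSet_mem_edgeSet (e : Sym2 V) :
    MeasurableSet {T : SimpleGraph V | e ∈ T.edgeSet} :=
  measurableSet_setOfPred.2 ((measurable_set_iff.1 SimpleGraph.measurable_edgeSet) e)

lemma upperEvent_eq_iInter (B : Finset (Sym2 V)) :
    upperEvent B = ⋂ e ∈ B, {T : SimpleGraph V | e ∈ T.edgeSet} := by
  ext T
  simp [upperEvent, Set.subset_def]

lemma measurableSet_upperEvent (B : Finset (Sym2 V)) : MeasurableSet (upperEvent B) := by
  rw [upperEvent_eq_iInter]
  exact B.measurableSet_biInter fun e _ => measurableSet_mem_edgeSet e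

lemma upperEvent_inter (B B' : Finset (Sym2 V)) :
    upperEvent B ∩ upperEvent B' = upperEvent (B ∪ B') := by
  ext T
  simp [upperEvent]

lemma isPiSystem_upperEvent : IsPiSystem (Set.range (upperEvent (V := V))) := by
  rintro _ ⟨B, rfl⟩ _ ⟨B', rfl⟩ _
  exact ⟨B ∪ B', (upperEvent_inter B B').symm⟩

lemma generateFrom_upperEvent :
    (inferInstance : MeasurableSpace (SimpleGraph V)) =
      MeasurableSpace.generateFrom (Set.range upperEvent) := by
  refine le_antisymm ?_ ?_
  · have h : @Measurable _ _ (MeasurableSpace.generateFrom (Set.range (upperEvent (V := V))))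
        inferInstance (id : SimpleGraph V → SimpleGraph V) := by
      rw [SimpleGraph.measurable_iff_adj]
      intro u v
      refine @measurableSet_setOfPred _ (MeasurableSpace.generateFrom _) _ |>.1 ?_
      refine MeasurableSpace.measurableSet_generateFrom ⟨{s(u, v)}, ?_⟩
      ext T
      simp [upperEvent]
    intro s hs
    exact h hs
  · refine MeasurableSpace.generateFrom_le ?_
    rintro _ ⟨B, rfl⟩
    exact measurableSet_upperEvent B

/-- Inclusion probabilities of finite sets determine a law, because these events form a generating
π-system. -/
lemma ext_of_upperEvent {μ ν : Measure (SimpleGraph V)} [IsProbabilityMeasure μ]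
    [IsProbabilityMeasure ν] (h : ∀ B, μ (upperEvent B) = ν (upperEvent B)) : μ = ν := by
  refine ext_of_generate_finite _ generateFrom_upperEvent isPiSystem_upperEvent ?_ (by simp)
  rintro _ ⟨B, rfl⟩
  exact h B

/-- The event that all pairs in `B` and no pairs in `D` are edges. -/
def avoidEvent (B D : Finset (Sym2 V)) : Set (SimpleGraph V) :=
  {T | (B : Set (Sym2 V)) ⊆ T.edgeSet ∧ ∀ d ∈ D, d ∉ T.edgeSet}

lemma avoidEvent_empty (B : Finset (Sym2 V)) : avoidEvent B ∅ = upperEvent B := by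
  ext T
  simp [avoidEvent, upperEvent]

lemma avoidEvent_insert (B D : Finset (Sym2 V)) (d : Sym2 V) :
    avoidEvent B (insert d D) = avoidEvent B D \ avoidEvent (insert d B) D := by
  ext T
  simp only [avoidEvent, Finset.forall_mem_insert, Set.mem_ofPred_eq, Set.mem_sdiff,
    Finset.coe_insert, Set.insert_subset_iff]
  tauto

lemma avoidEvent_insert_subset (B D : Finset (Sym2 V)) (d : Sym2 V) :
    avoidEvent (insert d B) D ⊆ avoidEvent B D := fun T hT => by
  simp only [avoidEvent, Set.mem_ofPred_eq, Finset.coe_insert, Set.insert_subset_iff] at hT ⊢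
  exact ⟨hT.1.2, hT.2⟩

lemma measurableSet_avoidEvent (B D : Finset (Sym2 V)) : MeasurableSet (avoidEvent B D) := by
  induction D using Finset.induction_on generalizing B with
  | empty => rw [avoidEvent_empty]; exact measurableSet_upperEvent B
  | insert d D _ ih => rw [avoidEvent_insert]; exact (ih B).diff (ih _)

lemma cylinder_eq_avoidEvent {F B : Finset (Sym2 V)} (h : B ⊆ F) :
    cylinder F B = avoidEvent B (F \ B) := by
  ext T
  simp only [cylinder, avoidEvent, Set.mem_ofPred_eq, Finset.mem_sdiff, Set.ext_iff,
    Set.mem_inter_iff, Finset.mem_coe, Set.subset_def]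
  constructor
  · exact fun H => ⟨fun x hx => ((H x).2 hx).1, fun d hd hdT => hd.2 ((H d).1 ⟨hdT, hd.1⟩)⟩
  · exact fun H x => ⟨fun hx => by_contra fun hxB => H.2 x ⟨hx.2, hxB⟩ hx.1,
      fun hx => ⟨H.1 x hx, h hx⟩⟩

lemma cylinder_eq_empty {F B : Finset (Sym2 V)} (h : ¬ B ⊆ F) : cylinder F B = ∅ := by
  refine Set.eq_empty_of_forall_notMem fun T hT => h ?_
  rw [← Finset.coe_subset, ← show T.edgeSet ∩ (F : Set (Sym2 V)) = B from hT]
  exact Set.inter_subset_right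

lemma cylinder_self (B : Finset (Sym2 V)) : cylinder B B = upperEvent B := by
  ext T
  simp [cylinder, upperEvent]

lemma measurableSet_cylinder (F B : Finset (Sym2 V)) : MeasurableSet (cylinder F B) := by
  by_cases h : B ⊆ F
  · rw [cylinder_eq_avoidEvent h]
    exact measurableSet_avoidEvent _ _
  · rw [cylinder_eq_empty h]
    exact MeasurableSet.empty

lemma uniformProb_sdiff {𝒯 A A' : Set (SimpleGraph V)} (h𝒯 : 𝒯.Finite) (h : A' ⊆ A) :
    uniformProb 𝒯 (A \ A') = uniformProb 𝒯 A - uniformProb 𝒯 A' := by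
  unfold uniformProb
  rw [← sub_div, Set.inter_sdiff_distrib_left,
    Set.ncard_sdiff (Set.inter_subset_inter_right 𝒯 h) (h𝒯.subset Set.inter_subset_left),
    Nat.cast_sub (Set.ncard_le_ncard (Set.inter_subset_inter_right 𝒯 h)
      (h𝒯.subset Set.inter_subset_left))]

/-- Inclusion–exclusion over the absent edges reduces every cylinder to inclusion events. -/
lemma isWeakLimit_of_upperEvent {𝒯 : ℕ → Set (SimpleGraph V)}
    {μ : ProbabilityMeasure (SimpleGraph V)} (h𝒯 : ∀ n, (𝒯 n).Finite)
    (h : ∀ B, Tendsto (fun n => uniformProb (𝒯 n) (upperEvent B)) atTop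
      (𝓝 ((μ : Measure (SimpleGraph V)).real (upperEvent B)))) : IsWeakLimit 𝒯 μ := by
  have key : ∀ D B : Finset (Sym2 V), Tendsto (fun n => uniformProb (𝒯 n) (avoidEvent B D)) atTop
      (𝓝 ((μ : Measure (SimpleGraph V)).real (avoidEvent B D))) := by
    intro D
    induction D using Finset.induction_on with
    | empty => intro B; rw [avoidEvent_empty]; exact h B
    | insert d D _ ih =>
      intro B
      rw [avoidEvent_insert, measureReal_sdiff (avoidEvent_insert_subset B D d)
        (measurableSet_avoidEvent _ _)]
      refine ((ih B).sub (ih (insert d B))).congr fun n => ?_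
      exact (uniformProb_sdiff (h𝒯 n) (avoidEvent_insert_subset B D d)).symm
  intro F B
  by_cases hBF : B ⊆ F
  · rw [cylinder_eq_avoidEvent hBF]
    exact key _ _
  · rw [cylinder_eq_empty hBF]
    simp [uniformProb]

lemma IsWeakLimit.upperEvent {𝒯 : ℕ → Set (SimpleGraph V)}
    {μ : ProbabilityMeasure (SimpleGraph V)} (h : IsWeakLimit 𝒯 μ) (B : Finset (Sym2 V)) :
    Tendsto (fun n => uniformProb (𝒯 n) (upperEvent B)) atTop
      (𝓝 ((μ : Measure (SimpleGraph V)).real (upperEvent B))) := by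
  rw [← cylinder_self]
  exact h B B

/-! ### Existence of limit measures -/

/-- Compactness: an ultrafilter limit of the uniform laws exists on the Cantor-type space `Sym2 V →
Bool`, and inclusion events are clopen there, so their probabilities pass to the limit. -/
lemma exists_measure_of_tendsto [Countable V] {G : SimpleGraph V} {C : ℕ → Set (Sym2 V)}
    {E : ℕ → Finset (Sym2 V)} (hE : ∀ n, (E n : Set (Sym2 V)) ⊆ G.edgeSet)
    {p : Finset (Sym2 V) → ℝ}
    (hp : ∀ B, Tendsto (fun n => baseProb (C n) (E n) B) atTop (𝓝 (p B))) :
    ∃ μ : ProbabilityMeasure (SimpleGraph V),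
      ∀ B, (μ : Measure (SimpleGraph V)).real (upperEvent B) = p B := by
  set ind : Finset (Sym2 V) → Sym2 V → Bool := fun A e => decide (e ∈ A) with hind
  set up : Finset (Sym2 V) → Set (Sym2 V → Bool) := fun B => {ω | ∀ b ∈ B, ω b = true} with hup
  have hclopen : ∀ B, IsClopen (up B) := by
    intro B
    have : up B = ⋂ b ∈ B, (fun ω : Sym2 V → Bool => ω b) ⁻¹' {true} := by ext; simp [hup]
    rw [this]
    exact B.finite_toSet.isClopen_biInter fun b _ =>
      (isClopen_discrete _).preimage (continuous_apply b)
  set P : ℕ → Measure (Sym2 V → Bool) := fun n =>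
    ((bases (C n) (E n)).card : ENNReal)⁻¹ • ∑ A ∈ bases (C n) (E n), Measure.dirac (ind A) with hP
  have hcard : ∀ n, ((bases (C n) (E n)).card : ENNReal) ≠ 0 := fun n => by
    exact_mod_cast (bases_nonempty (C n) (E n)).card_pos.ne'
  have hP1 : ∀ n, IsProbabilityMeasure (P n) := fun n => ⟨by
    simp only [hP, Measure.smul_apply, Measure.finsetSum_apply, measure_univ, Finset.sum_const,
      nsmul_eq_mul, mul_one, smul_eq_mul]
    exact ENNReal.inv_mul_cancel (hcard n) (ENNReal.natCast_ne_top _)⟩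
  have hPup : ∀ n B, (P n).real (up B) = baseProb (C n) (E n) B := by
    intro n B
    have hs : ∀ A : Finset (Sym2 V), (Measure.dirac (ind A)) (up B) = if B ⊆ A then 1 else 0 := by
      intro A
      rw [Measure.dirac_apply' _ (hclopen B).isOpen.measurableSet, Set.indicator_apply]
      refine if_congr ?_ rfl rfl
      simp [hup, hind, Finset.subset_iff]
    rw [measureReal_def, baseProb]
    simp only [hP, Measure.smul_apply, Measure.finsetSum_apply, hs, smul_eq_mul, ← Finset.sum_filter,
      Finset.sum_const, nsmul_eq_mul, mul_one, ENNReal.toReal_mul, ENNReal.toReal_inv,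
      ENNReal.toReal_natCast]
    exact (div_eq_inv_mul _ _).symm
  obtain ⟨ν, -, hν⟩ := (isCompact_univ : IsCompact
    (Set.univ : Set (ProbabilityMeasure (Sym2 V → Bool)))).ultrafilter_le_nhds
    ((hyperfilter ℕ).map fun n => ⟨P n, hP1 n⟩) (by simp)
  have hν' : Tendsto (β := ProbabilityMeasure (Sym2 V → Bool)) (fun n => ⟨P n, hP1 n⟩)
    (hyperfilter ℕ) (𝓝 ν) := hν
  have hνup : ∀ B, (ν : Measure (Sym2 V → Bool)).real (up B) = p B := by
    intro B
    have h1 := ProbabilityMeasure.tendsto_measure_of_null_frontier_of_tendsto' hν' (E := up B)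
      (by rw [(hclopen B).frontier_eq, measure_empty])
    have h2 := (ENNReal.tendsto_toReal (measure_ne_top (ν : Measure (Sym2 V → Bool)) (up B))).comp h1
    refine tendsto_nhds_unique h2 (((hp B).mono_left Nat.hyperfilter_le_atTop).congr fun n => ?_)
    exact (hPup n B).symm
  have hmeas : Measurable fun ω : Sym2 V → Bool => SimpleGraph.fromEdgeSet {e | ω e = true} := by
    refine SimpleGraph.measurable_fromEdgeSet.comp (measurable_set_iff.2 fun e => ?_)
    have h1 : MeasurableSet {ω : Sym2 V → Bool | ω e = true} :=
      measurableSet_eq_fun (measurable_pi_apply e) measurable_const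
    exact measurableSet_setOfPred.1 h1
  refine ⟨ν.map hmeas.aemeasurable, fun B => ?_⟩
  rw [ProbabilityMeasure.toMeasure_map, map_measureReal_apply hmeas (measurableSet_upperEvent B)]
  -- `SimpleGraph.fromEdgeSet` discards diagonal pairs; a set containing one has limiting
  -- probability zero, so nothing is lost.
  by_cases hB : ∀ b ∈ B, ¬ b.IsDiag
  · rw [← hνup B]
    congr 1
    ext ω
    simp only [upperEvent, hup, Set.preimage_ofPred_eq, SimpleGraph.edgeSet_fromEdgeSet,
      Set.mem_ofPred_eq, Set.subset_def, Finset.mem_coe, Set.mem_sdiff]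
    exact forall₂_congr fun b hb => and_iff_left (hB b hb)
  · push Not at hB
    obtain ⟨b, hb, hdiag⟩ := hB
    have h0 : p B = 0 := by
      refine tendsto_nhds_unique (hp B) (tendsto_const_nhds.congr fun n => ?_)
      exact (baseProb_eq_zero fun h => G.not_isDiag_of_mem_edgeSet (hE n (h hb)) hdiag).symm
    rw [h0, ← measureReal_empty (μ := (ν : Measure (Sym2 V → Bool)))]
    congr 1
    refine Set.eq_empty_of_forall_notMem fun ω hω => ?_
    exact SimpleGraph.not_isDiag_of_mem_edgeSet _ (hω hb) hdiag

section ForestMeasures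

variable {G : SimpleGraph V}

lemma finite_of_mem_iff {C : Set (Sym2 V)} {E : Finset (Sym2 V)} {𝒯 : Set (SimpleGraph V)}
    (h𝒯 : ∀ T, T ∈ 𝒯 ↔ ∃ A ∈ bases C E, graphOf A = T) : 𝒯.Finite := by
  have : 𝒯 = graphOf '' (bases C E : Set (Finset (Sym2 V))) := Set.ext h𝒯
  rw [this]
  exact (Finset.finite_toSet _).image _

lemma IsExhaustion.mem_spanningTrees_iff {Gn : ℕ → G.Subgraph} (h : IsExhaustion Gn) (n : ℕ)
    (T : SimpleGraph V) :
    T ∈ spanningTrees (Gn n) ↔ ∃ A ∈ bases ∅ (h.finite_edgeSet n).toFinset, graphOf A = T :=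
  SpanningForest.mem_spanningTrees_iff (h.connected n) (Set.Finite.coe_toFinset _) T

lemma IsExhaustion.tendsto_freeProb {Gn : ℕ → G.Subgraph} (h : IsExhaustion Gn)
    (B : Finset (Sym2 V)) :
    Tendsto (fun n => baseProb ∅ (h.finite_edgeSet n).toFinset B) atTop (𝓝 (freeProb G B)) := by
  refine SpanningForest.tendsto_freeProb (fun n => ?_) (fun e he => ?_) B
  · rw [Set.Finite.coe_toFinset]
    exact (Gn n).edgeSet_subset
  · filter_upwards [h.eventually_mem_edgeSet he] with n hn
    exact (Set.Finite.mem_toFinset _).2 hn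

/-- Inclusion probabilities tend to `freeProb` along every exhaustion, so testing a single one
already determines the measure. -/
lemma isFSF_iff (hG : G.Connected) (hfin : ∀ v, (G.neighborSet v).Finite)
    (μ : ProbabilityMeasure (SimpleGraph V)) :
    IsFSF G μ ↔ ∀ B, (μ : Measure (SimpleGraph V)).real (upperEvent B) = freeProb G B := by
  have huni : ∀ {Gn : ℕ → G.Subgraph} (h : IsExhaustion Gn) (B : Finset (Sym2 V)) (n : ℕ),
      uniformProb (spanningTrees (Gn n)) (upperEvent B) =
        baseProb ∅ (h.finite_edgeSet n).toFinset B := fun {Gn} h B n =>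
    uniformProb_upperEvent (by rw [Set.Finite.coe_toFinset]; exact (Gn n).edgeSet_subset)
      (h.mem_spanningTrees_iff n) B
  constructor
  · intro hμ B
    obtain ⟨Gn, hGn, -⟩ := exists_isExhaustion hG hfin
    refine tendsto_nhds_unique ((hμ Gn hGn).upperEvent B) ((hGn.tendsto_freeProb B).congr fun n => ?_)
    exact (huni hGn B n).symm
  · intro hμ Gn hGn
    refine isWeakLimit_of_upperEvent (fun n => finite_of_mem_iff (hGn.mem_spanningTrees_iff n))
      fun B => ?_
    rw [hμ B]
    exact (hGn.tendsto_freeProb B).congr fun n => (huni hGn B n).symm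

lemma isWSF_iff (hG : G.Connected) (hfin : ∀ v, (G.neighborSet v).Finite)
    (μ : ProbabilityMeasure (SimpleGraph V)) :
    IsWSF G μ ↔ ∀ B, (μ : Measure (SimpleGraph V)).real (upperEvent B) = wiredProb G B := by
  have hmem : ∀ {Gn : ℕ → G.Subgraph} (_ : IsExhaustion Gn) (n : ℕ) (T : SimpleGraph V),
      T ∈ wiredSpanningTrees G (Gn n).verts ↔
        ∃ A ∈ bases (outsidePairs (Gn n).verts) (touching G (Gn n).verts), graphOf A = T :=
    fun h n T => mem_wiredSpanningTrees_iff hG (coe_touching hfin (h.finite n)) T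
  have huni : ∀ {Gn : ℕ → G.Subgraph} (_ : IsExhaustion Gn) (B : Finset (Sym2 V)) (n : ℕ),
      uniformProb (wiredSpanningTrees G (Gn n).verts) (upperEvent B) =
        wiredBaseProb G (Gn n).verts B := fun h B n =>
    uniformProb_upperEvent (coe_touching_subset G _) (hmem h n) B
  have hlim : ∀ {Gn : ℕ → G.Subgraph} (_ : IsExhaustion Gn) (B : Finset (Sym2 V)),
      Tendsto (fun n => wiredBaseProb G (Gn n).verts B) atTop (𝓝 (wiredProb G B)) := fun h B =>
    tendsto_wiredProb hfin h.finite h.eventually_mem_verts B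
  constructor
  · intro hμ B
    obtain ⟨Gn, hGn, hind⟩ := exists_isExhaustion hG hfin
    refine tendsto_nhds_unique ((hμ Gn hGn hind).upperEvent B) ((hlim hGn B).congr fun n => ?_)
    exact (huni hGn B n).symm
  · intro hμ Gn hGn _
    refine isWeakLimit_of_upperEvent (fun n => finite_of_mem_iff (hmem hGn n)) fun B => ?_
    rw [hμ B]
    exact (hlim hGn B).congr fun n => (huni hGn B n).symm

/-- Existence of the limit ensures that the choice operator in the definition returns a genuine free
spanning forest measure. -/
lemma isFSF_FSF (hG : G.Connected) (hfin : ∀ v, (G.neighborSet v).Finite) : IsFSF G (FSF G) := by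
  have := countable_of_connected hG hfin
  obtain ⟨Gn, hGn, -⟩ := exists_isExhaustion hG hfin
  obtain ⟨μ, hμ⟩ := exists_measure_of_tendsto
    (fun n => by rw [Set.Finite.coe_toFinset]; exact (Gn n).edgeSet_subset) hGn.tendsto_freeProb
  exact Classical.epsilon_spec_aux ⟨μ⟩ (IsFSF G) ⟨μ, (isFSF_iff hG hfin μ).2 hμ⟩

lemma isWSF_WSF (hG : G.Connected) (hfin : ∀ v, (G.neighborSet v).Finite) : IsWSF G (WSF G) := by
  have := countable_of_connected hG hfin
  obtain ⟨Gn, hGn, -⟩ := exists_isExhaustion hG hfin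
  obtain ⟨μ, hμ⟩ := exists_measure_of_tendsto (fun n => coe_touching_subset G (Gn n).verts)
    fun B => tendsto_wiredProb hfin hGn.finite hGn.eventually_mem_verts B
  exact Classical.epsilon_spec_aux ⟨μ⟩ (IsWSF G) ⟨μ, (isWSF_iff hG hfin μ).2 hμ⟩

lemma FSF_upperEvent (hG : G.Connected) (hfin : ∀ v, (G.neighborSet v).Finite)
    (B : Finset (Sym2 V)) : (FSF G : Measure (SimpleGraph V)).real (upperEvent B) = freeProb G B :=
  (isFSF_iff hG hfin _).1 (isFSF_FSF hG hfin) B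

lemma WSF_upperEvent (hG : G.Connected) (hfin : ∀ v, (G.neighborSet v).Finite)
    (B : Finset (Sym2 V)) : (WSF G : Measure (SimpleGraph V)).real (upperEvent B) = wiredProb G B :=
  (isWSF_iff hG hfin _).1 (isWSF_WSF hG hfin) B

end ForestMeasures

/-! ### Components -/

/-- The edges inside a set of vertices, as pairs in the subtype. -/
def restrictTo (c : Set V) (E : Finset (Sym2 V)) : Finset (Sym2 c) :=
  E.preimage (Sym2.map Subtype.val) (Sym2.map.injective Subtype.val_injective).injOn

lemma mem_restrictTo {c : Set V} {E : Finset (Sym2 V)} {e : Sym2 c} :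
    e ∈ restrictTo c E ↔ Sym2.map Subtype.val e ∈ E := Finset.mem_preimage

/-- The inclusion of the pairs in a set of vertices. -/
def pairEmbedding (c : Set V) : Sym2 c ↪ Sym2 V :=
  ⟨Sym2.map Subtype.val, Sym2.map.injective Subtype.val_injective⟩

lemma restrictTo_map (c : Set V) (E : Finset (Sym2 c)) :
    restrictTo c (E.map (pairEmbedding c)) = E := by
  ext e
  rw [mem_restrictTo]
  exact Finset.mem_map' (pairEmbedding c)

lemma spans_outsidePairs_iff (S c : Set V) (A : Finset (Sym2 c)) (e : Sym2 c) :
    Spans (outsidePairs (Subtype.val ⁻¹' S : Set c) ∪ A) e ↔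
      Spans (outsidePairs S ∪ (A.map (pairEmbedding c) : Finset (Sym2 V))) (pairEmbedding c e) := by
  constructor
  · intro h ψ hψ
    refine (constOn_map _ _ _).2 (h _ ?_)
    rintro a (ha | ha)
    · rw [← constOn_map]
      refine hψ _ (Or.inl fun v hv => ?_)
      obtain ⟨w, hw, rfl⟩ := Sym2.mem_map.1 hv
      exact ha w hw
    · rw [← constOn_map]
      exact hψ _ (Or.inr (Finset.mem_coe.2 (Finset.mem_map_of_mem _ ha)))
  · intro h ψ hψ
    have hout : ∀ x y : c, x.1 ∉ S → y.1 ∉ S → ψ x = ψ y := fun x y hx hy =>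
      (constOn_mk ψ x y).1 (hψ _ (Or.inl fun v hv => by
        rcases Sym2.mem_iff.1 hv with rfl | rfl
        exacts [hx, hy]))
    -- All vertices of `c` outside `S` share one value of `ψ`; give that value to every vertex
    -- outside `c`, or `False` if there is none.
    set ψ' : V → Prop := fun w => if hw : w ∈ c then ψ ⟨w, hw⟩ else ∃ z : c, z.1 ∉ S ∧ ψ z with hψ'
    have hcomp : ψ' ∘ Subtype.val = ψ := by
      funext w
      simp [hψ']
    have hval : ∀ x, x ∉ S → ψ' x = ∃ z : c, z.1 ∉ S ∧ ψ z := by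
      intro x hx
      simp only [hψ']
      split_ifs with hxc
      · exact propext ⟨fun h' => ⟨⟨x, hxc⟩, hx, h'⟩, fun ⟨z, hz, hz'⟩ => (hout z ⟨x, hxc⟩ hz hx) ▸ hz'⟩
      · rfl
    have := h ψ' ?_
    · rwa [pairEmbedding, Function.Embedding.coeFn_mk, constOn_map, hcomp] at this
    · rintro a (ha | ha)
      · induction a with
        | _ x y =>
          rw [constOn_mk, hval x (ha x (Sym2.mem_mk_left _ _)), hval y (ha y (Sym2.mem_mk_right _ _))]
      · obtain ⟨b, hb, rfl⟩ := Finset.mem_map.1 (Finset.mem_coe.1 ha)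
        rw [pairEmbedding, Function.Embedding.coeFn_mk, constOn_map, hcomp]
        exact hψ b (Or.inr hb)

/-- The component of the source of a pair. -/
def compKey (H : SimpleGraph V) (e : Sym2 V) : H.ConnectedComponent :=
  H.connectedComponentMk (edgeSrc e)

/-- Both vertices of the pair lie in the same component of `H`. -/
def InComponent (H : SimpleGraph V) (e : Sym2 V) : Prop :=
  ∀ v ∈ e, H.connectedComponentMk v = compKey H e

lemma edgeSrc_mem (e : Sym2 V) : edgeSrc e ∈ e := Sym2.out_fst_mem e

lemma inComponent_iff {H : SimpleGraph V} {e : Sym2 V} :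
    InComponent H e ↔ ∃ c : H.ConnectedComponent, ∀ v ∈ e, v ∈ c := by
  constructor
  · exact fun h => ⟨compKey H e, fun v hv => h v hv⟩
  · rintro ⟨c, hc⟩ v hv
    exact (hc v hv : H.connectedComponentMk v = c).trans (hc _ (edgeSrc_mem e)).symm

lemma inComponent_of_mem_edgeSet {H : SimpleGraph V} {e : Sym2 V} (he : e ∈ H.edgeSet) :
    InComponent H e := by
  rw [inComponent_iff]
  induction e with
  | _ x y =>
    refine ⟨H.connectedComponentMk x, fun v hv => ?_⟩
    rcases Sym2.mem_iff.1 hv with rfl | rfl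
    · rfl
    · exact SimpleGraph.ConnectedComponent.sound (SimpleGraph.Adj.reachable he).symm

/-- After wiring, distinct components of `H` meet at most in the wired vertex, so they form a direct
sum: a cut may be flattened on the other components to its value outside `S`. -/
lemma decoupled_components (H : SimpleGraph V) (S : Set V) {E : Finset (Sym2 V)}
    (hE : (E : Set (Sym2 V)) ⊆ H.edgeSet) :
    ∀ A ⊆ E, ∀ e ∈ E, Spans (outsidePairs S ∪ A) e →
      Spans (outsidePairs S ∪ (A.filter (compKey H · = compKey H e) : Finset (Sym2 V))) e := by
  intro A hA e he h ψ hψ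
  have hout : ∀ x y : V, x ∉ S → y ∉ S → ψ x = ψ y := fun x y hx hy =>
    (constOn_mk ψ x y).1 (hψ _ (Or.inl fun v hv => by
      rcases Sym2.mem_iff.1 hv with rfl | rfl
      exacts [hx, hy]))
  set ψ' : V → Prop := fun w => if H.connectedComponentMk w = compKey H e then ψ w
    else ∃ z, z ∉ S ∧ ψ z with hψ'
  have hval : ∀ x, x ∉ S → ψ' x = ∃ z, z ∉ S ∧ ψ z := by
    intro x hx
    simp only [hψ']
    split_ifs with hxc
    · exact propext ⟨fun h' => ⟨x, hx, h'⟩, fun ⟨z, hz, hz'⟩ => (hout z x hz hx) ▸ hz'⟩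
    · rfl
  have hend : ∀ a ∈ E, H.connectedComponentMk (edgeSrc a) = compKey H a ∧
      H.connectedComponentMk (edgeTgt a) = compKey H a := fun a ha =>
    ⟨rfl, inComponent_of_mem_edgeSet (hE ha) _ (Sym2.out_snd_mem a)⟩
  have hin : ∀ a ∈ E, compKey H a = compKey H e → (ConstOn ψ' a ↔ ConstOn ψ a) := by
    intro a ha hae
    simp only [ConstOn, hψ', (hend a ha).1, (hend a ha).2, hae, if_true]
  rw [← hin e he rfl]
  refine h ψ' ?_
  rintro a (ha | ha)
  · induction a with
    | _ x y =>
      rw [constOn_mk, hval x (ha x (Sym2.mem_mk_left _ _)), hval y (ha y (Sym2.mem_mk_right _ _))]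
  · by_cases hae : compKey H a = compKey H e
    · rw [hin a (hA ha) hae]
      exact hψ a (Or.inr (Finset.mem_coe.2 (Finset.mem_filter.2 ⟨ha, hae⟩)))
    · simp only [ConstOn, hψ', (hend a (hA ha)).1, (hend a (hA ha)).2, hae, if_false]

lemma map_restrictTo {H : SimpleGraph V} {B : Finset (Sym2 V)} (hB : ∀ b ∈ B, InComponent H b)
    (c : H.ConnectedComponent) :
    (restrictTo (c : Set V) B).map (pairEmbedding (c : Set V)) =
      B.filter (compKey H · = c) := by
  ext e
  rw [Finset.mem_map, Finset.mem_filter]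
  constructor
  · rintro ⟨a, ha, rfl⟩
    refine ⟨mem_restrictTo.1 ha, ?_⟩
    have h1 : edgeSrc (pairEmbedding (c : Set V) a) ∈ Sym2.map Subtype.val a := edgeSrc_mem _
    obtain ⟨w, -, hw⟩ := Sym2.mem_map.1 h1
    rw [compKey, ← hw]
    exact w.2
  · rintro ⟨heB, hec⟩
    have hin : ∀ v ∈ e, v ∈ (c : Set V) := fun v hv => (hB e heB v hv).trans hec
    have h1 : ∃ a : Sym2 (c : Set V), Sym2.map Subtype.val a = e := by
      induction e with
      | _ x y =>
        exact ⟨s(⟨x, hin x (Sym2.mem_mk_left _ _)⟩, ⟨y, hin y (Sym2.mem_mk_right _ _)⟩), rfl⟩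
    obtain ⟨a, rfl⟩ := h1
    exact ⟨a, mem_restrictTo.2 heB, rfl⟩

lemma restrictTo_eq_empty {H : SimpleGraph V} {B : Finset (Sym2 V)}
    (hB : ∀ b ∈ B, InComponent H b) {I : Finset H.ConnectedComponent} (hI : ∀ b ∈ B, compKey H b ∈ I)
    {c : H.ConnectedComponent} (hc : c ∉ I) : restrictTo (c : Set V) B = ∅ := by
  rw [← Finset.map_eq_empty (f := pairEmbedding (c : Set V)), map_restrictTo hB,
    Finset.filter_eq_empty_iff]
  exact fun b hb h => hc (h ▸ hI b hb)

/-- `I` need only cover the components meeting `B`; each remaining one contributes the factor `1`.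
-/
lemma baseProb_components (H : SimpleGraph V) (S : Set V) {E B : Finset (Sym2 V)}
    (hE : (E : Set (Sym2 V)) ⊆ H.edgeSet) (hB : ∀ b ∈ B, InComponent H b)
    {I : Finset H.ConnectedComponent} (hI : ∀ b ∈ B, compKey H b ∈ I) :
    baseProb (outsidePairs S) E B = ∏ c ∈ I,
      baseProb (outsidePairs (Subtype.val ⁻¹' S : Set (c : Set V))) (restrictTo (c : Set V) E)
        (restrictTo (c : Set V) B) := by
  have h1 := baseProb_of_decoupled (decoupled_components H S hE) (I := I ∪ E.image (compKey H))
    (fun e he => Finset.mem_union_right _ (Finset.mem_image_of_mem _ he))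
    (fun b hb => Finset.mem_union_left _ (hI b hb))
  rw [h1, Finset.prod_subset (Finset.subset_union_left (s₁ := I) (s₂ := E.image (compKey H)))]
  · refine Finset.prod_congr rfl fun c _ => ?_
    rw [← map_restrictTo hB, ← map_restrictTo fun e he => inComponent_of_mem_edgeSet (hE he)]
    exact baseProb_map _ (fun A _ e _ => spans_outsidePairs_iff S c A e) _
  · intro c _ hc
    rw [restrictTo_eq_empty hB hI hc, baseProb_empty]

/-- Makes the free case an instance of the wired factorization, with `S` the whole vertex set. -/
lemma outsidePairs_univ : outsidePairs (Set.univ : Set V) = ∅ :=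
  Set.eq_empty_of_forall_notMem fun e he => he _ (edgeSrc_mem e) trivial

section ProductFormula

variable {H : SimpleGraph V}

lemma toSimpleGraph_finite (hfin : ∀ v, (H.neighborSet v).Finite) (c : H.ConnectedComponent)
    (v : (c : Set V)) : (c.toSimpleGraph.neighborSet v).Finite :=
  Set.Finite.of_finite_image (f := Subtype.val)
    ((hfin v).subset (by rintro _ ⟨w, hw, rfl⟩; exact hw)) Subtype.val_injective.injOn

lemma mem_edgeSet_toSimpleGraph {c : H.ConnectedComponent} {e : Sym2 (c : Set V)} :
    e ∈ (c.toSimpleGraph : SimpleGraph (c : Set V)).edgeSet ↔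
      Sym2.map Subtype.val e ∈ H.edgeSet := by
  induction e with
  | _ x y => rfl

lemma mem_outsidePairs_map {S c : Set V} {e : Sym2 c} :
    Sym2.map Subtype.val e ∈ outsidePairs S ↔ e ∈ outsidePairs (Subtype.val ⁻¹' S : Set c) := by
  induction e with
  | _ x y =>
    simp only [outsidePairs, Set.mem_ofPred_eq, Sym2.map_mk, Sym2.mem_iff, forall_eq_or_imp,
      forall_eq, Set.mem_preimage]

lemma restrictTo_touching (hfin : ∀ v, (H.neighborSet v).Finite) {S : Set V} (hS : S.Finite)
    (c : H.ConnectedComponent) : restrictTo (c : Set V) (touching H S) =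
      touching (c.toSimpleGraph : SimpleGraph (c : Set V)) (Subtype.val ⁻¹' S) := by
  ext e
  rw [mem_restrictTo, mem_touching hfin hS]
  exact (and_congr mem_edgeSet_toSimpleGraph.symm (not_congr mem_outsidePairs_map)).trans
    (mem_touching (toSimpleGraph_finite hfin c) (hS.preimage Subtype.val_injective.injOn)).symm

lemma eventually_mem_touching (hfin : ∀ v, (H.neighborSet v).Finite) {S : ℕ → Set V}
    (hS : ∀ n, (S n).Finite) (hcover : ∀ v, ∀ᶠ n in atTop, v ∈ S n) {e : Sym2 V}
    (he : e ∈ H.edgeSet) : ∀ᶠ n in atTop, e ∈ touching H (S n) := by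
  filter_upwards [hcover (edgeSrc e)] with n hn
  rw [mem_touching hfin (hS n)]
  exact ⟨he, fun ho => ho _ (edgeSrc_mem e) hn⟩

lemma wiredProb_eq_prod (hfin : ∀ v, (H.neighborSet v).Finite) {S : ℕ → Set V}
    (hS : ∀ n, (S n).Finite) (hcover : ∀ v, ∀ᶠ n in atTop, v ∈ S n) {B : Finset (Sym2 V)}
    (hB : ∀ b ∈ B, InComponent H b)
    {I : Finset H.ConnectedComponent} (hI : ∀ b ∈ B, compKey H b ∈ I) :
    wiredProb H B = ∏ c ∈ I, wiredProb (c.toSimpleGraph : SimpleGraph (c : Set V))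
      (restrictTo (c : Set V) B) := by
  refine tendsto_nhds_unique (tendsto_wiredProb hfin hS hcover B) ?_
  have h1 : ∀ n, wiredBaseProb H (S n) B = ∏ c ∈ I,
      wiredBaseProb (c.toSimpleGraph : SimpleGraph (c : Set V)) (Subtype.val ⁻¹' S n)
        (restrictTo (c : Set V) B) := by
    intro n
    unfold wiredBaseProb
    rw [baseProb_components H (S n) (coe_touching_subset H (S n)) hB hI]
    exact Finset.prod_congr rfl fun c _ => by rw [restrictTo_touching hfin (hS n)]; rfl
  simp_rw [h1]
  exact tendsto_finsetProd I fun c _ => tendsto_wiredProb (toSimpleGraph_finite hfin c)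
    (fun n => (hS n).preimage Subtype.val_injective.injOn) (fun v => hcover v) _

lemma freeProb_eq_prod (hfin : ∀ v, (H.neighborSet v).Finite) {S : ℕ → Set V}
    (hS : ∀ n, (S n).Finite) (hcover : ∀ v, ∀ᶠ n in atTop, v ∈ S n) {B : Finset (Sym2 V)}
    (hB : ∀ b ∈ B, InComponent H b)
    {I : Finset H.ConnectedComponent} (hI : ∀ b ∈ B, compKey H b ∈ I) :
    freeProb H B = ∏ c ∈ I, freeProb (c.toSimpleGraph : SimpleGraph (c : Set V))
      (restrictTo (c : Set V) B) := by
  refine tendsto_nhds_unique (tendsto_freeProb (fun n => coe_touching_subset H (S n))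
    (fun e he => eventually_mem_touching hfin hS hcover he) B) ?_
  have h1 : ∀ n, baseProb ∅ (touching H (S n)) B = ∏ c ∈ I,
      baseProb ∅ (restrictTo (c : Set V) (touching H (S n))) (restrictTo (c : Set V) B) := by
    intro n
    have := baseProb_components H Set.univ (coe_touching_subset H (S n)) hB hI
    simpa only [Set.preimage_univ, outsidePairs_univ] using this
  simp_rw [h1]
  refine tendsto_finsetProd I fun c _ => tendsto_freeProb (fun n e he => ?_) (fun e he => ?_) _
  · exact mem_edgeSet_toSimpleGraph.2 (coe_touching_subset H (S n) (mem_restrictTo.1 he))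
  · filter_upwards [eventually_mem_touching hfin hS hcover (mem_edgeSet_toSimpleGraph.1 he)]
      with n hn
    exact mem_restrictTo.2 hn

lemma wiredProb_eq_zero {B : Finset (Sym2 V)} (hB : ¬ (B : Set (Sym2 V)) ⊆ H.edgeSet) :
    wiredProb H B = 0 := by
  unfold wiredProb wiredBaseProb
  have : ∀ S : Finset V, baseProb (outsidePairs (S : Set V)) (touching H S) B = 0 := fun S =>
    baseProb_eq_zero fun h => hB ((Finset.coe_subset.2 h).trans (coe_touching_subset H S))
  simp [this]

lemma freeProb_eq_zero {B : Finset (Sym2 V)} (hB : ¬ (B : Set (Sym2 V)) ⊆ H.edgeSet) :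
    freeProb H B = 0 := if_neg hB

end ProductFormula

/-! ### The componentwise wired spanning forest -/

section Componentwise

variable {H : SimpleGraph V}

lemma unionOfComponents_adj (T : ∀ c : H.ConnectedComponent, SimpleGraph c) (u v : V) :
    (unionOfComponents H T).Adj u v ↔ ∃ c : H.ConnectedComponent, ∃ (hu : u ∈ c) (hv : v ∈ c),
      (T c).Adj ⟨u, hu⟩ ⟨v, hv⟩ := by
  unfold unionOfComponents
  rw [SimpleGraph.iSup_adj]
  refine exists_congr fun c => ?_
  rw [SimpleGraph.map_adj']
  constructor
  · rintro ⟨-, u', v', h, rfl, rfl⟩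
    exact ⟨u'.2, v'.2, h⟩
  · rintro ⟨hu, hv, h⟩
    exact ⟨fun huv => h.ne (Subtype.ext huv), _, _, h, rfl, rfl⟩

lemma unionOfComponents_adj_iff (T : ∀ c : H.ConnectedComponent, SimpleGraph c)
    {c : H.ConnectedComponent} {u v : V} (hu : u ∈ c) (hv : v ∈ c) :
    (unionOfComponents H T).Adj u v ↔ (T c).Adj ⟨u, hu⟩ ⟨v, hv⟩ := by
  rw [unionOfComponents_adj]
  constructor
  · rintro ⟨c', hu', hv', h⟩
    obtain rfl : c' = c := (SimpleGraph.ConnectedComponent.mem_supp_iff _ _ |>.1 hu').symm.trans hu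
    exact h
  · exact fun h => ⟨c, hu, hv, h⟩

lemma measurable_unionOfComponents (H : SimpleGraph V) : Measurable (unionOfComponents H) := by
  rw [SimpleGraph.measurable_iff_adj]
  intro u v
  by_cases huv : H.connectedComponentMk u = H.connectedComponentMk v
  · have hu : u ∈ H.connectedComponentMk v := huv
    have hv : v ∈ H.connectedComponentMk v := rfl
    have : (fun T => (unionOfComponents H T).Adj u v) =
        fun T => (T (H.connectedComponentMk v)).Adj ⟨u, hu⟩ ⟨v, hv⟩ := by
      funext T
      exact propext (unionOfComponents_adj_iff T hu hv)
    rw [this]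
    exact (SimpleGraph.measurable_iff_adj.1 measurable_id _ _).comp (measurable_pi_apply _)
  · have : (fun T => (unionOfComponents H T).Adj u v) = fun _ => False := by
      funext T
      refine propext ⟨fun h => ?_, False.elim⟩
      obtain ⟨c, hu, hv, -⟩ := (unionOfComponents_adj T u v).1 h
      exact huv (Eq.trans hu hv.symm)
    rw [this]
    exact measurable_const

instance (H : SimpleGraph V) : IsProbabilityMeasure (componentwiseWSF H) :=
  Measure.isProbabilityMeasure_map (measurable_unionOfComponents H).aemeasurable

lemma unionOfComponents_preimage_upperEvent {B : Finset (Sym2 V)} (hB : ∀ b ∈ B, InComponent H b)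
    {I : Finset H.ConnectedComponent} (hI : ∀ b ∈ B, compKey H b ∈ I) :
    unionOfComponents H ⁻¹' upperEvent B =
      Set.pi (I : Set H.ConnectedComponent) fun c => upperEvent (restrictTo (c : Set V) B) := by
  have key : ∀ (T : ∀ c : H.ConnectedComponent, SimpleGraph c) (c : H.ConnectedComponent)
      (e : Sym2 (c : Set V)), Sym2.map Subtype.val e ∈ (unionOfComponents H T).edgeSet ↔
        e ∈ (T c : SimpleGraph (c : Set V)).edgeSet := by
    intro T c e
    induction e with
    | _ x y => exact unionOfComponents_adj_iff T x.2 y.2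
  ext T
  simp only [Set.mem_preimage, upperEvent, Set.mem_ofPred_eq, Set.mem_pi, Finset.mem_coe]
  constructor
  · intro h c _ e he
    exact (key T c e).1 (h (mem_restrictTo.1 he))
  · intro h b hb
    have h1 : b ∈ (restrictTo (compKey H b : Set V) B).map (pairEmbedding _) := by
      rw [map_restrictTo hB]
      exact Finset.mem_filter.2 ⟨hb, rfl⟩
    obtain ⟨e, he, hbe⟩ := Finset.mem_map.1 h1
    rw [← hbe]
    exact (key T _ e).2 (h _ (hI b hb) he)

/-- Independence gives a product over the components meeting `B`, which is `wiredProb` of the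
possibly disconnected graph `H`. If some pair of `B` joins two components, both sides vanish. -/
lemma componentwiseWSF_upperEvent (hfin : ∀ v, (H.neighborSet v).Finite) {S : ℕ → Set V}
    (hS : ∀ n, (S n).Finite) (hcover : ∀ v, ∀ᶠ n in atTop, v ∈ S n) (B : Finset (Sym2 V)) :
    componentwiseWSF H (upperEvent B) = ENNReal.ofReal (wiredProb H B) := by
  unfold componentwiseWSF
  rw [Measure.map_apply (measurable_unionOfComponents H) (measurableSet_upperEvent B)]
  by_cases hB : ∀ b ∈ B, InComponent H b
  · have hI : ∀ b ∈ B, compKey H b ∈ B.image (compKey H) := fun b hb => Finset.mem_image_of_mem _ hb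
    rw [unionOfComponents_preimage_upperEvent hB hI, Measure.infinitePi_pi _
      fun c _ => measurableSet_upperEvent _, wiredProb_eq_prod hfin hS hcover hB hI,
      ENNReal.ofReal_prod_of_nonneg fun c _ => ?_]
    · refine Finset.prod_congr rfl fun c _ => ?_
      rw [← WSF_upperEvent c.connected_toSimpleGraph (toSimpleGraph_finite hfin c),
        ofReal_measureReal]
    · rw [← WSF_upperEvent c.connected_toSimpleGraph (toSimpleGraph_finite hfin c)]
      exact measureReal_nonneg
  · rw [wiredProb_eq_zero fun h => hB fun b hb => inComponent_of_mem_edgeSet (h hb),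
      ENNReal.ofReal_zero]
    push Not at hB
    obtain ⟨b, hb, hbc⟩ := hB
    rw [← measure_empty (μ := Measure.infinitePi fun c : H.ConnectedComponent =>
      (WSF c.toSimpleGraph : Measure (SimpleGraph c)))]
    congr 1
    refine Set.eq_empty_of_forall_notMem fun T hT => hbc ?_
    have hbT : b ∈ (unionOfComponents H T).edgeSet := hT hb
    rw [inComponent_iff]
    induction b with
    | _ x y =>
      obtain ⟨c, hx, hy, -⟩ := (unionOfComponents_adj T x y).1 hbT
      refine ⟨c, fun v hv => ?_⟩
      rcases Sym2.mem_iff.1 hv with rfl | rfl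
      exacts [hx, hy]

end Componentwise

/-! ### The wired spanning forest resampled inside its components -/

/-- The edges of `D` present in a graph. -/
def present (D : Finset (Sym2 V)) (F : SimpleGraph V) : Finset (Sym2 V) :=
  D.filter (· ∈ F.edgeSet)

lemma mem_present {D : Finset (Sym2 V)} {F : SimpleGraph V} {e : Sym2 V} :
    e ∈ present D F ↔ e ∈ D ∧ e ∈ F.edgeSet := Finset.mem_filter

lemma present_eq_iff {D A : Finset (Sym2 V)} {F : SimpleGraph V} :
    present D F = A ↔ F ∈ cylinder D A := by
  rw [cylinder, Set.mem_ofPred_eq, ← Finset.coe_inj]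
  refine Eq.congr_left ?_
  ext e
  simp [mem_present, and_comm]

lemma comp_present_eq_sum (g : Finset (Sym2 V) → ℝ) (D : Finset (Sym2 V)) (F : SimpleGraph V) :
    g (present D F) = ∑ A ∈ D.powerset, (cylinder D A).indicator (fun _ => g A) F := by
  rw [Finset.sum_eq_single_of_mem (present D F)
    (Finset.mem_powerset.2 (Finset.filter_subset _ _))]
  · rw [Set.indicator_of_mem (present_eq_iff.1 rfl)]
  · intro A _ hA
    exact Set.indicator_of_notMem (fun h => hA (present_eq_iff.2 h).symm) _

lemma measurable_comp_present (g : Finset (Sym2 V) → ℝ) (D : Finset (Sym2 V)) :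
    Measurable fun F : SimpleGraph V => g (present D F) := by
  simp_rw [comp_present_eq_sum g D]
  exact Finset.measurable_fun_sum _ fun A _ =>
    measurable_const.indicator (measurableSet_cylinder D A)

lemma integral_comp_present (g : Finset (Sym2 V) → ℝ) (D : Finset (Sym2 V))
    (μ : Measure (SimpleGraph V)) [IsProbabilityMeasure μ] :
    ∫ F, g (present D F) ∂μ = ∑ A ∈ D.powerset, g A * μ.real (cylinder D A) := by
  simp_rw [comp_present_eq_sum g D]
  rw [integral_finsetSum]
  · refine Finset.sum_congr rfl fun A _ => ?_
    rw [integral_indicator_const _ (measurableSet_cylinder D A), smul_eq_mul, mul_comm]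
  · exact fun A _ => (integrable_const _).indicator (measurableSet_cylinder D A)

lemma exists_finset_spans {F : SimpleGraph V} {u v : V} (h : F.Reachable u v) :
    ∃ A : Finset (Sym2 V), (A : Set (Sym2 V)) ⊆ F.edgeSet ∧ Spans (A : Set (Sym2 V)) s(u, v) := by
  obtain ⟨p⟩ := h
  induction p with
  | nil => exact ⟨∅, by simp, spans_of_isDiag (by simp)⟩
  | @cons u w v h p ih =>
    obtain ⟨A, hA, hs⟩ := ih
    refine ⟨insert s(u, w) A, ?_, fun ψ hψ => ?_⟩
    · rw [Finset.coe_insert]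
      exact Set.insert_subset h hA
    · have h1 := (constOn_mk ψ u w).1 (hψ _ (by simp))
      have h2 := (constOn_mk ψ w v).1 (hs ψ fun a ha => hψ a (by simp [Finset.mem_coe.1 ha]))
      exact (constOn_mk ψ u v).2 (h1.trans h2)

lemma reachable_iff_exists_finset {F : SimpleGraph V} {u v : V} : F.Reachable u v ↔
    ∃ A : Finset (Sym2 V), F ∈ upperEvent A ∧ Spans (A : Set (Sym2 V)) s(u, v) :=
  ⟨exists_finset_spans, fun ⟨_, hA, hs⟩ => (reachable_iff_spans F u v).2 (hs.mono hA)⟩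

/-- A connecting path has finitely many edges, so reachability is a countable union of inclusion
events. -/
lemma measurable_inducedComponentGraph [Countable V] (G : SimpleGraph V) :
    Measurable (inducedComponentGraph G) := by
  rw [SimpleGraph.measurable_iff_adj]
  intro u v
  refine measurableSet_setOfPred.1 ?_
  have : {F : SimpleGraph V | (inducedComponentGraph G F).Adj u v} =
      ⋃ A : Finset (Sym2 V), if G.Adj u v ∧ Spans (A : Set (Sym2 V)) s(u, v)
        then upperEvent A else ∅ := by
    ext F
    simp only [inducedComponentGraph, reachable_iff_exists_finset, Set.mem_ofPred_eq,
      Set.mem_iUnion]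
    constructor
    · rintro ⟨h, A, hA, hs⟩
      exact ⟨A, by rwa [if_pos ⟨h, hs⟩]⟩
    · rintro ⟨A, hA⟩
      split_ifs at hA with h
      · exact ⟨h.1, A, hA, h.2⟩
      · exact absurd hA (Set.notMem_empty F)
  rw [this]
  refine MeasurableSet.iUnion fun A => ?_
  split_ifs
  · exact measurableSet_upperEvent A
  · exact MeasurableSet.empty

lemma inducedComponentGraph_le (G F : SimpleGraph V) : inducedComponentGraph G F ≤ G :=
  fun _ _ h => h.1

lemma neighborSet_finite_of_le {G H : SimpleGraph V} (hHG : H ≤ G)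
    (hfin : ∀ v, (G.neighborSet v).Finite) (v : V) : (H.neighborSet v).Finite :=
  (hfin v).subset fun _ hw => hHG hw

lemma touching_of_le {G H : SimpleGraph V} (hHG : H ≤ G) (hfin : ∀ v, (G.neighborSet v).Finite)
    {S : Set V} (hS : S.Finite) : touching H S = present (touching G S) H := by
  ext e
  rw [mem_present, mem_touching hfin hS, mem_touching (neighborSet_finite_of_le hHG hfin) hS]
  have := @SimpleGraph.edgeSet_mono _ _ _ hHG e
  tauto

section Main

variable {G : SimpleGraph V}

/-- A pointwise limit of functions of finitely many edges of the induced-component graph. -/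
lemma measurable_wiredProb [Countable V] (hfin : ∀ v, (G.neighborSet v).Finite) {S : ℕ → Set V}
    (hS : ∀ n, (S n).Finite) (hcover : ∀ v, ∀ᶠ n in atTop, v ∈ S n) (B : Finset (Sym2 V)) :
    Measurable fun F => wiredProb (inducedComponentGraph G F) B := by
  refine measurable_of_tendsto_metrizable (f := fun n F =>
    wiredBaseProb (inducedComponentGraph G F) (S n) B) (fun n => ?_) ?_
  · unfold wiredBaseProb
    simp_rw [touching_of_le (inducedComponentGraph_le G _) hfin (hS n)]
    exact (measurable_comp_present (fun A => baseProb (outsidePairs (S n)) A B) _).comp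
      (measurable_inducedComponentGraph G)
  · rw [tendsto_pi_nhds]
    exact fun F => tendsto_wiredProb
      (neighborSet_finite_of_le (inducedComponentGraph_le G F) hfin) hS hcover B

lemma measurable_freeProb [Countable V] (hfin : ∀ v, (G.neighborSet v).Finite) {S : ℕ → Set V}
    (hS : ∀ n, (S n).Finite) (hcover : ∀ v, ∀ᶠ n in atTop, v ∈ S n) (B : Finset (Sym2 V)) :
    Measurable fun F => freeProb (inducedComponentGraph G F) B := by
  refine measurable_of_tendsto_metrizable (f := fun n F =>
    baseProb ∅ (touching (inducedComponentGraph G F) (S n)) B) (fun n => ?_) ?_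
  · simp_rw [touching_of_le (inducedComponentGraph_le G _) hfin (hS n)]
    exact (measurable_comp_present (fun A => baseProb ∅ A B) _).comp
      (measurable_inducedComponentGraph G)
  · rw [tendsto_pi_nhds]
    exact fun F => tendsto_freeProb (fun n => coe_touching_subset _ (S n))
      (fun e he => eventually_mem_touching
        (neighborSet_finite_of_le (inducedComponentGraph_le G F) hfin) hS hcover he) B

lemma wiredProb_nonneg (H : SimpleGraph V) (B : Finset (Sym2 V)) : 0 ≤ wiredProb H B :=
  (baseProb_nonneg _ _ _).trans (le_ciSup (bddAbove_wiredBaseProb H B) ∅)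

lemma freeProb_nonneg (H : SimpleGraph V) (B : Finset (Sym2 V)) : 0 ≤ freeProb H B := by
  unfold freeProb
  split_ifs
  · exact Real.iInf_nonneg fun E => baseProb_nonneg _ _ _
  · exact le_rfl

lemma freeProb_le_one (H : SimpleGraph V) (B : Finset (Sym2 V)) : freeProb H B ≤ 1 := by
  unfold freeProb
  split_ifs with h
  · exact (ciInf_le ⟨0, by rintro _ ⟨A, rfl⟩; exact baseProb_nonneg _ _ _⟩
      ⟨B, subset_rfl, h⟩).trans (baseProb_le_one _ _ _)
  · exact zero_le_one

/-- The wired spanning forest is supported on subgraphs of `G`. -/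
lemma ae_le_of_WSF (hG : G.Connected) (hfin : ∀ v, (G.neighborSet v).Finite) :
    ∀ᵐ F ∂(WSF G : Measure (SimpleGraph V)), F ≤ G := by
  have := countable_of_connected hG hfin
  have h : ∀ᵐ F ∂(WSF G : Measure (SimpleGraph V)), ∀ e : Sym2 V, e ∉ G.edgeSet → e ∉ F.edgeSet := by
    rw [ae_all_iff]
    intro e
    by_cases he : e ∈ G.edgeSet
    · exact Eventually.of_forall fun F h => absurd he h
    · have h0 := WSF_upperEvent hG hfin {e}
      rw [wiredProb_eq_zero (by simpa using he), measureReal_eq_zero_iff] at h0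
      filter_upwards [measure_eq_zero_iff_ae_notMem.1 h0] with F hF _ heF
      exact hF (by simpa [upperEvent] using heF)
  filter_upwards [h] with F hF
  rw [← SimpleGraph.edgeSet_subset_edgeSet]
  exact fun e he => by_contra fun h => hF e h he

/-- Resampling the wired spanning forest inside a finite set of edges, given its components
inside that set, does not change its law. -/
lemma WSF_upperEvent_eq_integral (hG : G.Connected) (hfin : ∀ v, (G.neighborSet v).Finite)
    {D B : Finset (Sym2 V)} (hD : (D : Set (Sym2 V)) ⊆ G.edgeSet) (hB : B ⊆ D) :
    (WSF G : Measure (SimpleGraph V)).real (upperEvent B) =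
      ∫ F, baseProb ∅ (closureIn D (present D F)) B ∂(WSF G : Measure (SimpleGraph V)) := by
  obtain ⟨Gn, hGn, hind⟩ := exists_isExhaustion hG hfin
  have hlim := isWSF_WSF hG hfin Gn hGn hind
  have hmem : ∀ n T, T ∈ wiredSpanningTrees G (Gn n).verts ↔
      ∃ A ∈ bases (outsidePairs (Gn n).verts) (touching G (Gn n).verts), graphOf A = T :=
    fun n T => mem_wiredSpanningTrees_iff hG (coe_touching hfin (hGn.finite n)) T
  set g : Finset (Sym2 V) → ℝ := fun A => baseProb ∅ (closureIn D A) B with hg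
  rw [integral_comp_present g D]
  -- For fixed `D` the integral is a finite combination of cylinder probabilities, so weak
  -- convergence applies to both sides of the finite identity.
  refine tendsto_nhds_unique (hlim.upperEvent B)
    ((tendsto_finsetSum _ fun A _ => (hlim D A).const_mul (g A)).congr' ?_)
  have hDn : ∀ᶠ n in atTop, D ⊆ touching G (Gn n).verts :=
    eventually_subset_of_forall fun e he =>
      eventually_mem_touching hfin hGn.finite hGn.eventually_mem_verts (hD he)
  filter_upwards [hDn] with n hn
  rw [uniformProb_upperEvent (coe_touching_subset G _) (hmem n), baseProb,
    card_filter_eq_sum_baseProb _ hn hB]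
  have h1 : ∀ T ∈ bases (outsidePairs (Gn n).verts) (touching G (Gn n).verts),
      baseProb ∅ (closureIn D (T ∩ D)) B =
        ∑ A ∈ D.powerset, g A * if graphOf T ∈ cylinder D A then 1 else 0 := by
    intro T hT
    have hpres : present D (graphOf T) = T ∩ D := by
      ext e
      rw [mem_present, edgeSet_graphOf ((Finset.coe_subset.2 (mem_bases.1 hT).subset).trans
        (coe_touching_subset G _)), Finset.mem_inter, Finset.mem_coe, and_comm]
    rw [← hpres, show baseProb ∅ (closureIn D (present D (graphOf T))) B =
      g (present D (graphOf T)) from rfl, comp_present_eq_sum g D]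
    refine Finset.sum_congr rfl fun A _ => ?_
    rw [Set.indicator_apply, mul_ite, mul_one, mul_zero]
  rw [Finset.sum_congr rfl h1, Finset.sum_comm, Finset.sum_div]
  refine Finset.sum_congr rfl fun A _ => ?_
  rw [uniformProb_eq (coe_touching_subset G _) (hmem n), ← Finset.mul_sum, mul_div_assoc,
    Finset.card_filter]
  push_cast
  rfl

/-- The wired spanning forest of `G` is a mixture of free spanning forests of its induced
components. -/
lemma WSF_upperEvent_eq_integral_freeProb (hG : G.Connected)
    (hfin : ∀ v, (G.neighborSet v).Finite) (B : Finset (Sym2 V)) :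
    (WSF G : Measure (SimpleGraph V)).real (upperEvent B) =
      ∫ F, freeProb (inducedComponentGraph G F) B ∂(WSF G : Measure (SimpleGraph V)) := by
  by_cases hB : (B : Set (Sym2 V)) ⊆ G.edgeSet
  · obtain ⟨Gn, hGn, -⟩ := exists_isExhaustion hG hfin
    set D : ℕ → Finset (Sym2 V) := fun n => touching G (Gn n).verts with hD
    have hDG : ∀ n, (D n : Set (Sym2 V)) ⊆ G.edgeSet := fun n => coe_touching_subset G _
    have hDe : ∀ e ∈ G.edgeSet, ∀ᶠ n in atTop, e ∈ D n := fun e he =>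
      eventually_mem_touching hfin hGn.finite hGn.eventually_mem_verts he
    have hlim : Tendsto (fun n => ∫ F, baseProb ∅ (closureIn (D n) (present (D n) F)) B
        ∂(WSF G : Measure (SimpleGraph V))) atTop
        (𝓝 (∫ F, freeProb (inducedComponentGraph G F) B ∂(WSF G : Measure (SimpleGraph V)))) := by
      refine tendsto_integral_of_dominated_convergence (fun _ => 1)
        (fun n => ?_) (integrable_const 1) (fun n => Eventually.of_forall fun F => ?_) ?_
      · exact (measurable_comp_present (fun A => baseProb ∅ (closureIn (D n) A) B)
          (D n)).aestronglyMeasurable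
      · rw [Real.norm_eq_abs, abs_of_nonneg (baseProb_nonneg _ _ _)]
        exact baseProb_le_one _ _ _
      -- The closures lie in the induced-component graph, and each of its edges enters eventually: a
      -- path in `F` joining its ends is finite and, as `F ≤ G`, is finally contained in `D n`.
      · filter_upwards [ae_le_of_WSF hG hfin] with F hF
        refine tendsto_freeProb (fun n e he => ?_) (fun e he => ?_) B
        · obtain ⟨heD, hes⟩ := mem_closureIn.1 (Finset.mem_coe.1 he)
          have hes' : Spans F.edgeSet e := hes.mono fun a ha => (mem_present.1 ha).2
          have heG := hDG n heD
          induction e with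
          | _ u v => exact ⟨heG, (reachable_iff_spans F u v).2 hes'⟩
        · induction e with
          | _ u v =>
            obtain ⟨A, hA, hs⟩ := exists_finset_spans he.2
            filter_upwards [hDe s(u, v) he.1, eventually_subset_of_forall fun a ha =>
              hDe a (SimpleGraph.edgeSet_mono hF (hA ha))] with n hn hAn
            exact mem_closureIn.2 ⟨hn, hs.mono fun a ha => mem_present.2 ⟨hAn ha, hA ha⟩⟩
    -- Once `B ⊆ D n` the integrals all equal the same inclusion probability.
    refine tendsto_nhds_unique (tendsto_const_nhds.congr' ?_) hlim
    filter_upwards [eventually_subset_of_forall fun b hb => hDe b (hB hb)] with n hn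
    exact WSF_upperEvent_eq_integral hG hfin (hDG n) hn
  · rw [WSF_upperEvent hG hfin, wiredProb_eq_zero hB]
    have : ∀ F, freeProb (inducedComponentGraph G F) B = 0 := fun F => freeProb_eq_zero fun h =>
      hB (h.trans (SimpleGraph.edgeSet_mono (inducedComponentGraph_le G F)))
    simp [this]

lemma measurable_componentwiseWSF (hG : G.Connected) (hfin : ∀ v, (G.neighborSet v).Finite) :
    Measurable fun F => componentwiseWSF (inducedComponentGraph G F) := by
  have := countable_of_connected hG hfin
  obtain ⟨Gn, hGn, -⟩ := exists_isExhaustion hG hfin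
  refine Measurable.measure_of_isPiSystem_of_isProbabilityMeasure generateFrom_upperEvent
    isPiSystem_upperEvent ?_
  rintro _ ⟨B, rfl⟩
  simp_rw [fun F => componentwiseWSF_upperEvent (neighborSet_finite_of_le
    (inducedComponentGraph_le G F) hfin) hGn.finite hGn.eventually_mem_verts B]
  exact (measurable_wiredProb hfin hGn.finite hGn.eventually_mem_verts B).ennreal_ofReal

lemma resampledWSF_upperEvent (hG : G.Connected) (hfin : ∀ v, (G.neighborSet v).Finite)
    (B : Finset (Sym2 V)) :
    resampledWSF (WSF G : Measure (SimpleGraph V)) (inducedComponentGraph G) (upperEvent B) =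
      ∫⁻ F, ENNReal.ofReal (wiredProb (inducedComponentGraph G F) B)
        ∂(WSF G : Measure (SimpleGraph V)) := by
  obtain ⟨Gn, hGn, -⟩ := exists_isExhaustion hG hfin
  unfold resampledWSF
  rw [Measure.bind_apply (measurableSet_upperEvent B)
    (measurable_componentwiseWSF hG hfin).aemeasurable]
  exact lintegral_congr fun F => componentwiseWSF_upperEvent (neighborSet_finite_of_le
    (inducedComponentGraph_le G F) hfin) hGn.finite hGn.eventually_mem_verts B

lemma WSF_upperEvent_eq_lintegral_freeProb (hG : G.Connected)
    (hfin : ∀ v, (G.neighborSet v).Finite) (B : Finset (Sym2 V)) :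
    (WSF G : Measure (SimpleGraph V)) (upperEvent B) =
      ∫⁻ F, ENNReal.ofReal (freeProb (inducedComponentGraph G F) B)
        ∂(WSF G : Measure (SimpleGraph V)) := by
  have := countable_of_connected hG hfin
  obtain ⟨Gn, hGn, -⟩ := exists_isExhaustion hG hfin
  rw [← ofReal_measureReal, WSF_upperEvent_eq_integral_freeProb hG hfin,
    ofReal_integral_eq_lintegral_ofReal]
  · refine Integrable.of_bound (measurable_freeProb hfin hGn.finite hGn.eventually_mem_verts
      B).aestronglyMeasurable 1 (Eventually.of_forall fun F => ?_)
    rw [Real.norm_eq_abs, abs_of_nonneg (freeProb_nonneg _ _)]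
    exact freeProb_le_one _ _
  · exact Eventually.of_forall fun F => freeProb_nonneg _ _

/-- The free and the wired spanning forests agree on all components of `H` if and only if the
corresponding inclusion probabilities agree. -/
lemma forall_FSF_eq_WSF_iff {H : SimpleGraph V} (hfin : ∀ v, (H.neighborSet v).Finite)
    {S : ℕ → Set V} (hS : ∀ n, (S n).Finite) (hcover : ∀ v, ∀ᶠ n in atTop, v ∈ S n) :
    (∀ c : H.ConnectedComponent, FSF c.toSimpleGraph = WSF c.toSimpleGraph) ↔
      ∀ B, freeProb H B = wiredProb H B := by
  constructor
  · intro h B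
    by_cases hB : (B : Set (Sym2 V)) ⊆ H.edgeSet
    · have hBc : ∀ b ∈ B, InComponent H b := fun b hb => inComponent_of_mem_edgeSet (hB hb)
      have hI : ∀ b ∈ B, compKey H b ∈ B.image (compKey H) :=
        fun b hb => Finset.mem_image_of_mem _ hb
      rw [freeProb_eq_prod hfin hS hcover hBc hI, wiredProb_eq_prod hfin hS hcover hBc hI]
      refine Finset.prod_congr rfl fun c _ => ?_
      rw [← FSF_upperEvent c.connected_toSimpleGraph (toSimpleGraph_finite hfin c),
        ← WSF_upperEvent c.connected_toSimpleGraph (toSimpleGraph_finite hfin c)]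
      exact congrArg (fun μ : ProbabilityMeasure (SimpleGraph c) =>
        (μ : Measure (SimpleGraph c)).real _) (h c)
    · rw [freeProb_eq_zero hB, wiredProb_eq_zero hB]
  · intro h c
    have hc := c.connected_toSimpleGraph
    have hcfin := toSimpleGraph_finite hfin c
    suffices key : ∀ B, (FSF c.toSimpleGraph : Measure (SimpleGraph c)).real (upperEvent B) =
        (WSF c.toSimpleGraph : Measure (SimpleGraph c)).real (upperEvent B) by
      exact Subtype.ext (ext_of_upperEvent (μ := (FSF c.toSimpleGraph : Measure (SimpleGraph c)))
        (ν := (WSF c.toSimpleGraph : Measure (SimpleGraph c)))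
        fun B => (measureReal_eq_measureReal_iff).1 (key B))
    intro B
    -- Pushed forward to `V`, the set lives in the single component `c`, and the product formulas
    -- collapse to one factor.
    set B' : Finset (Sym2 V) := B.map (pairEmbedding (c : Set V)) with hB'
    have hkey : ∀ b ∈ B', ∀ v ∈ b, v ∈ c := by
      intro b hb v hv
      obtain ⟨a, -, rfl⟩ := Finset.mem_map.1 hb
      obtain ⟨w, -, rfl⟩ := Sym2.mem_map.1 hv
      exact w.2
    have hBc : ∀ b ∈ B', InComponent H b := fun b hb => inComponent_iff.2 ⟨c, hkey b hb⟩
    have hI : ∀ b ∈ B', compKey H b ∈ ({c} : Finset H.ConnectedComponent) := fun b hb =>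
      Finset.mem_singleton.2 (hkey b hb _ (edgeSrc_mem b))
    have h1 := h B'
    rw [freeProb_eq_prod hfin hS hcover hBc hI, wiredProb_eq_prod hfin hS hcover hBc hI,
      Finset.prod_singleton, Finset.prod_singleton, hB', restrictTo_map] at h1
    exact (FSF_upperEvent hc hcfin B).trans (h1.trans (WSF_upperEvent hc hcfin B).symm)

/-- Equality of the laws is equality of two integrals for each `B`, with integrands ordered
pointwise. Finiteness of the integrals forces almost sure equality, and countability of the finite
sets `B` gives it simultaneously. -/
theorem resampledWSF_eq_WSF_iff (hG : G.Connected) (hfin : ∀ v, (G.neighborSet v).Finite) :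
    resampledWSF (WSF G : Measure (SimpleGraph V)) (inducedComponentGraph G) =
        (WSF G : Measure (SimpleGraph V)) ↔
      ∀ᵐ F ∂(WSF G : Measure (SimpleGraph V)),
        ∀ c : (inducedComponentGraph G F).ConnectedComponent,
          FSF c.toSimpleGraph = WSF c.toSimpleGraph := by
  have := countable_of_connected hG hfin
  obtain ⟨Gn, hGn, -⟩ := exists_isExhaustion hG hfin
  have hfin' : ∀ F v, ((inducedComponentGraph G F).neighborSet v).Finite := fun F =>
    neighborSet_finite_of_le (inducedComponentGraph_le G F) hfin
  simp_rw [fun F => forall_FSF_eq_WSF_iff (hfin' F) hGn.finite hGn.eventually_mem_verts]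
  rw [ae_all_iff]
  have hmw := fun B => (measurable_wiredProb hfin hGn.finite hGn.eventually_mem_verts
    B).ennreal_ofReal
  have hmf := fun B => (measurable_freeProb hfin hGn.finite hGn.eventually_mem_verts
    B).ennreal_ofReal
  have hle : ∀ B F, ENNReal.ofReal (wiredProb (inducedComponentGraph G F) B) ≤
      ENNReal.ofReal (freeProb (inducedComponentGraph G F) B) := fun B F =>
    ENNReal.ofReal_le_ofReal (wiredProb_le_freeProb (hfin' F) B)
  constructor
  · intro h B
    have h1 : ∫⁻ F, ENNReal.ofReal (freeProb (inducedComponentGraph G F) B)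
        ∂(WSF G : Measure (SimpleGraph V)) ≤
        ∫⁻ F, ENNReal.ofReal (wiredProb (inducedComponentGraph G F) B)
        ∂(WSF G : Measure (SimpleGraph V)) := by
      rw [← WSF_upperEvent_eq_lintegral_freeProb hG hfin, ← resampledWSF_upperEvent hG hfin, h]
    have hne : ∫⁻ F, ENNReal.ofReal (wiredProb (inducedComponentGraph G F) B)
        ∂(WSF G : Measure (SimpleGraph V)) ≠ ⊤ := by
      rw [← resampledWSF_upperEvent hG hfin, h]
      exact measure_ne_top _ _
    filter_upwards [ae_eq_of_ae_le_of_lintegral_le (Eventually.of_forall (hle B)) hne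
      (hmf B).aemeasurable h1] with F hF
    exact ((ENNReal.ofReal_eq_ofReal_iff (wiredProb_nonneg _ _) (freeProb_nonneg _ _)).1 hF).symm
  · intro h
    have : IsProbabilityMeasure
        (resampledWSF (WSF G : Measure (SimpleGraph V)) (inducedComponentGraph G)) :=
      isProbabilityMeasure_bind (measurable_componentwiseWSF hG hfin).aemeasurable
        (Eventually.of_forall fun F => inferInstance)
    refine ext_of_upperEvent fun B => ?_
    rw [resampledWSF_upperEvent hG hfin, WSF_upperEvent_eq_lintegral_freeProb hG hfin]
    refine lintegral_congr_ae ?_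
    filter_upwards [h B] with F hF
    rw [hF]

end Main

end

end SpanningForest

theorem corollary1p5 {V : Type*} [Infinite V] (G : SimpleGraph V) [G.LocallyFinite]
    (hG : G.Connected) :
    SpanningForest.resampledWSF (SpanningForest.WSF G : Measure (SimpleGraph V))
        (fun F => SpanningForest.inducedComponentGraph G F) =
        (SpanningForest.WSF G : Measure (SimpleGraph V)) ↔
      ∀ᵐ F ∂(SpanningForest.WSF G : Measure (SimpleGraph V)),
        ∀ c : (SpanningForest.inducedComponentGraph G F).ConnectedComponent,
          SpanningForest.FSF c.toSimpleGraph = SpanningForest.WSF c.toSimpleGraph :=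
  SpanningForest.resampledWSF_eq_WSF_iff hG fun v => Set.toFinite (G.neighborSet v)
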